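/- Let $n,m\in\mathbb N$, $N=n(n+m)$, $\alpha\in(0,1)$, and let $\Sigma_z,P_0\in\mathbb R^{N\times N}$, $\Sigma_w\in\mathbb R^{n\times n}$ be symmetric positive semidefinite and $\bar z_0\in\mathbb R^N$. Let the vectorized parameters $z_k=\operatorname{vec}(\Theta_k)\in\mathbb R^N$, $\Theta_k^{\mathsf T}=[A_k\ B_k]$, follow the random walk $z_{k+1}=z_k+\Delta z_k$, with $z_0\sim\mathcal N(\bar z_0,P_0)$, $\Delta z_k\sim\mathcal N(0,\Sigma_z)$ and process noise $w_k\sim\mathcal N(0,\Sigma_w)$, where the jointly Gaussian pairs $(\Delta z_k,w_k)$, $k\ge 0$, are independent over $k$ with $\mathbb E(\Delta z_k w_k^{\mathsf T})=0$, and $z_0$ is independent of the sequence $(\Delta z_k,w_k)_{k\ge0}$. Let $C_k=\mathrm I_n\otimes[x_k^{\mathsf T}\ u_k^{\mathsf T}]$, where the initial state $x_0$ and possibly an external excitation are jointly independent of $(z_0,(\Delta z_k,w_k)_{k\ge0})$ and each input $u_k\in\mathbb R^m$ is a measurable function of $x_0,\dots,x_k$ and of the external excitation. For an estimate $(\hat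 z,P)$ with regressor $C$ and observation $y$, the measurement update is $$S=CPC^{\mathsf T}+\Sigma_w,\qquad K=PC^{\mathsf T}S^{-1},\qquad (\hat z,P)\mapsto\bigl(\hat z+K(y-C\hat z),\;P-KCP\bigr),$$ and the time update is $(\hat z,P)\mapsto(\hat z,P+\Sigma_z)$. Let $(\hat z_{k|k},P_{k|k})$ be the Kalman filter estimate started at $(\hat z_{0|0},P_{0|0})=(\bar z_0,P_0)$, in either of the following two timing conventions: (a) the states satisfy $x_{k+1}=C_kz_k+w_k$, and the filter step from $k$ to $k+1$ is the measurement update with $C=C_k$, $y=x_{k+1}$, followed by the time update; (b) the states satisfy $x_{k+1}=C_kz_{k+1}+w_k$, and the filter step from $k$ to $k+1$ is the time update followed by the measurement update with $C=C_k$, $y=x_{k+1}$. Fix $k\ge0$. Assume that the inverses that occur exist almost surely, i.e. the innovation covariances $S$ of the first $k$ steps and $P_{k|k}$ are nonsingular (this is automatic if $\Sigma_w$ and $P_0$ are positive definite). Let the learning trigger be $$\gamma_{\mathrm{learn}}=1\iff(\hat z_{k|k}-\hat z^*)^{\mathsf T}P_{k|k}^{-1}(\hat z_{k|k}-\hat z^*)>\chi^2_{1-\alpha,\,n(n+m)},$$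 with the $(1-\alpha)$-quantile of the $\chi^2$ distribution with $n(n+m)$ degrees of freedom on the right, and $\gamma_{\mathrm{learn}}=0$ otherwise. Then, in case of a perfect model, i.e. $\hat z^*=z_k$ almost surely, in both conventions, $$\mathbb P[\gamma_{\mathrm{learn}}=1]\le\alpha .$$ -/

import Mathlib

open MeasureTheory ProbabilityTheory
open scoped Kronecker Matrix

noncomputable section

namespace ParameterFilter

/-- Index set of the vectorized parameters `z = vec Θ`, `Θᵀ = [A B]`: the entry `z (i, j)` is
`[A B] i j = Θ j i`.  It has `n * (n + m)` elements. -/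
abbrev ParamIdx (n m : ℕ) : Type := Fin n × (Fin n ⊕ Fin m)

/-- The space of vectorized parameters, `ℝ^(n(n+m))`. -/
abbrev Param (n m : ℕ) : Type := ParamIdx n m → ℝ

/-- The regressor matrix `C = I_n ⊗ dᵀ` with `dᵀ = [xᵀ uᵀ]`. -/
def regressor {n m : ℕ} (x : Fin n → ℝ) (u : Fin m → ℝ) :
    Matrix (Fin n) (ParamIdx n m) ℝ :=
  ((1 : Matrix (Fin n) (Fin n) ℝ) ⊗ₖ Matrix.replicateRow Unit (Sum.elim x u)).submatrix
    (fun i => (i, ())) id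

/-- The normal distribution `𝒩(μ, S)` on `ℝ^ι` (meant for positive semidefinite `S`). -/
def normalLaw {ι : Type} [Fintype ι] [DecidableEq ι] (μ : ι → ℝ) (S : Matrix ι ι ℝ) :
    Measure (ι → ℝ) :=
  (multivariateGaussian (WithLp.toLp 2 μ) S).map WithLp.ofLp

/-- The random-walk parameters and the noise: `z (k+1) = z k + Δz k` with `Δz k ∼ 𝒩(0, Sz)` and
`w k ∼ 𝒩(0, Sw)`; the (jointly Gaussian) pairs `(Δz k, w k)` are independent over time with
`E[Δz k (w k)ᵀ] = 0`; the initial value `z 0 ∼ 𝒩(z₀, P₀)` is independent of the noise.  The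
σ-algebra `𝓔` carries all randomness from outside: the initial state and, possibly, an external
excitation of the inputs. -/
structure IsParameterProcess {Ω : Type*} (𝓔 : MeasurableSpace Ω) [mΩ : MeasurableSpace Ω]
    (P : Measure Ω) {n m : ℕ}
    (z₀ : Param n m) (P₀ Sz : Matrix (ParamIdx n m) (ParamIdx n m) ℝ)
    (Sw : Matrix (Fin n) (Fin n) ℝ)
    (z Δz : ℕ → Ω → Param n m) (w : ℕ → Ω → Fin n → ℝ) : Prop where
  measurable_init : Measurable (z 0)
  measurable_Δz : ∀ k, Measurable (Δz k)
  measurable_w : ∀ k, Measurable (w k)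
  walk : ∀ k ω, z (k + 1) ω = z k ω + Δz k ω
  law_init : HasLaw (z 0) (normalLaw z₀ P₀) P
  law_Δz : ∀ k, HasLaw (Δz k) (normalLaw 0 Sz) P
  law_w : ∀ k, HasLaw (w k) (normalLaw 0 Sw) P
  gaussian_pair : ∀ k, HasGaussianLaw (fun ω => (Δz k ω, w k ω)) P
  uncorrelated : ∀ k i j, ∫ ω, Δz k ω i * w k ω j ∂P = 0
  indep_time : iIndepFun (fun k ω => (Δz k ω, w k ω)) P
  indep_init : IndepFun (z 0) (fun ω k => (Δz k ω, w k ω)) P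
  exogenous_le : 𝓔 ≤ mΩ
  indep_exogenous : Indep 𝓔
    (MeasurableSpace.comap (fun ω => (z 0 ω, fun k => (Δz k ω, w k ω))) inferInstance) P

/-- `(x, u)` is a trajectory of the lifted system `x (k+1) = C k * θ k + w k`,
`C k = I_n ⊗ [(x k)ᵀ (u k)ᵀ]`, where `θ k` is the parameter active in the transition from `k`
to `k+1`.  The inputs are causal: `u k` depends on the states up to time `k` and on the external
randomness `𝓔` only (arbitrary measurable feedback is allowed). -/
structure IsTrajectory {Ω : Type*} (𝓔 : MeasurableSpace Ω) {n m : ℕ}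
    (θ : ℕ → Ω → Param n m) (w : ℕ → Ω → Fin n → ℝ)
    (x : ℕ → Ω → Fin n → ℝ) (u : ℕ → Ω → Fin m → ℝ) : Prop where
  init : Measurable[𝓔] (x 0)
  step : ∀ k ω, x (k + 1) ω = regressor (x k ω) (u k ω) *ᵥ θ k ω + w k ω
  causal : ∀ k, Measurable[𝓔 ⊔ ⨆ i : Fin (k + 1), MeasurableSpace.comap (x i) inferInstance] (u k)

/-- A filter state: point estimate and error covariance. -/
structure Estimate (n m : ℕ) where
  mean : Param n m
  cov : Matrix (ParamIdx n m) (ParamIdx n m) ℝ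

/-- Time update: `ẑ ↦ ẑ`, `P ↦ P + Sz`. -/
def Estimate.predict {n m : ℕ} (Sz : Matrix (ParamIdx n m) (ParamIdx n m) ℝ)
    (s : Estimate n m) : Estimate n m :=
  ⟨s.mean, s.cov + Sz⟩

/-- Innovation covariance `S = C P Cᵀ + Sw`. -/
def Estimate.innovationCov {n m : ℕ} (Sw : Matrix (Fin n) (Fin n) ℝ) (s : Estimate n m)
    (C : Matrix (Fin n) (ParamIdx n m) ℝ) : Matrix (Fin n) (Fin n) ℝ :=
  C * s.cov * Cᵀ + Sw

/-- Kalman gain `K = P Cᵀ S⁻¹`. -/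
def Estimate.gain {n m : ℕ} (Sw : Matrix (Fin n) (Fin n) ℝ) (s : Estimate n m)
    (C : Matrix (Fin n) (ParamIdx n m) ℝ) : Matrix (ParamIdx n m) (Fin n) ℝ :=
  s.cov * Cᵀ * (s.innovationCov Sw C)⁻¹

/-- Measurement update with the observation `y`: `ẑ ↦ ẑ + K (y - C ẑ)`, `P ↦ P - K C P`. -/
def Estimate.correct {n m : ℕ} (Sw : Matrix (Fin n) (Fin n) ℝ) (s : Estimate n m)
    (C : Matrix (Fin n) (ParamIdx n m) ℝ) (y : Fin n → ℝ) : Estimate n m :=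
  ⟨s.mean + s.gain Sw C *ᵥ (y - C *ᵥ s.mean), s.cov - s.gain Sw C * C * s.cov⟩

/-- The filter `(ẑ_{k|k}, P_{k|k})` when `x (k+1)` is an observation of `z (k+1)`: predict from
`k` to `k+1`, then correct with `x (k+1)`. -/
def predictCorrect {n m : ℕ} (Sz : Matrix (ParamIdx n m) (ParamIdx n m) ℝ)
    (Sw : Matrix (Fin n) (Fin n) ℝ) (s₀ : Estimate n m)
    (x : ℕ → Fin n → ℝ) (u : ℕ → Fin m → ℝ) : ℕ → Estimate n m
  | 0 => s₀
  | k + 1 => ((predictCorrect Sz Sw s₀ x u k).predict Sz).correct Sw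
      (regressor (x k) (u k)) (x (k + 1))

/-- The filter `(ẑ_{k|k}, P_{k|k})` when `x (k+1)` is an observation of `z k`: correct the
estimate of `z k` with `x (k+1)`, then predict from `k` to `k+1`. -/
def correctPredict {n m : ℕ} (Sz : Matrix (ParamIdx n m) (ParamIdx n m) ℝ)
    (Sw : Matrix (Fin n) (Fin n) ℝ) (s₀ : Estimate n m)
    (x : ℕ → Fin n → ℝ) (u : ℕ → Fin m → ℝ) : ℕ → Estimate n m
  | 0 => s₀
  | k + 1 => ((correctPredict Sz Sw s₀ x u k).correct Sw
      (regressor (x k) (u k)) (x (k + 1))).predict Sz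

/-- The `χ²` distribution with `d` degrees of freedom: the law of the sum of the squares of `d`
independent standard normal variables. -/
def chiSquared (d : ℕ) : Measure ℝ :=
  (Measure.pi fun _ : Fin d => gaussianReal 0 1).map fun g => ∑ i, g i ^ 2

/-- The `p`-quantile of a probability distribution on `ℝ`. -/
def quantile (μ : Measure ℝ) (p : ℝ) : ℝ := sInf {t : ℝ | p ≤ cdf μ t}

/-- The squared Mahalanobis distance `(ẑ - z⋆)ᵀ P⁻¹ (ẑ - z⋆)` of `z⋆` from an estimate. -/
def Estimate.mahalanobisSq {n m : ℕ} (s : Estimate n m) (zstar : Param n m) : ℝ :=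
  (s.mean - zstar) ⬝ᵥ s.cov⁻¹ *ᵥ (s.mean - zstar)

open Classical in
/-- The learning trigger `γ_learn ∈ {0, 1}`. -/
def learningTrigger {n m : ℕ} (α : ℝ) (s : Estimate n m) (zstar : Param n m) : ℕ :=
  if s.mahalanobisSq zstar > quantile (chiSquared (n * (n + m))) (1 - α) then 1 else 0

end ParameterFilter

end

/-! The regressors depend on past states through arbitrary feedback, so parameters and states are
not jointly Gaussian and the Kalman filter cannot be justified by joint normality. Conditionally on
the information `infoSigma 𝓔 x k`, however, the next regressor is a known matrix, and each filter
step is an exact Gaussian computation. The invariant is that, given this information, `z k - ẑ` is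
normal with mean zero and the filter's own covariance (`IsPosterior`). The Mahalanobis distance is
then χ²-distributed given the information, hence also unconditionally, and it exceeds the `(1 -
α)`-quantile with probability at most `α`.

Conditional normality (`CondNormal`) is encoded without conditional distributions: the
characteristic function identity is integrated over every set of the conditioning σ-algebra, for
deterministic arguments. `setIntegral_freeze` extends it to arguments measurable for that σ-algebra,
which gives linear images under random matrices (`CondNormal.mulVec`). The time update adds
independent noise (`CondNormal.add_indep`). For the measurement update, the Kalman gain makes the
innovation and the new error conditionally uncorrelated (`kalman_blockDiag`); by uniqueness of
Fourier transforms, conditioning on the innovation then leaves the law of the new error unchanged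
(`CondNormal.condition`).

The two timing conventions differ in the order of the updates and in the independence they need:
`indep_Δz` serves one and `indep_w` the other. -/

noncomputable section

namespace ParameterFilter

/-! ### Independence of σ-algebras, freezing of random parameters, uniqueness of Fourier transforms
-/

section Generic

variable {Ω : Type*} {mΩ : MeasurableSpace Ω} {P : Measure Ω}

/-- The supremum of two σ-algebras is generated by the π-system of binary intersections. -/
lemma sup_eq_generateFrom_inter (F G : MeasurableSpace Ω) :
    F ⊔ G = MeasurableSpace.generateFrom
      {s | ∃ A B, MeasurableSet[F] A ∧ MeasurableSet[G] B ∧ A ∩ B = s} := by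
  refine le_antisymm (sup_le ?_ ?_) (MeasurableSpace.generateFrom_le ?_)
  · intro A hA
    exact MeasurableSpace.measurableSet_generateFrom ⟨A, Set.univ, hA, .univ, by simp⟩
  · intro B hB
    exact MeasurableSpace.measurableSet_generateFrom ⟨Set.univ, B, .univ, hB, by simp⟩
  · rintro _ ⟨A, B, hA, hB, rfl⟩
    exact MeasurableSet.inter (le_sup_left (a := F) (b := G) _ hA)
      (le_sup_right (a := F) (b := G) _ hB)

lemma isPiSystem_inter_measurableSet (F G : MeasurableSpace Ω) :
    IsPiSystem {s | ∃ A B, MeasurableSet[F] A ∧ MeasurableSet[G] B ∧ A ∩ B = s} := by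
  rintro _ ⟨A, B, hA, hB, rfl⟩ _ ⟨A', B', hA', hB', rfl⟩ -
  exact ⟨A ∩ A', B ∩ B', hA.inter hA', hB.inter hB', Set.inter_inter_inter_comm _ _ _ _⟩

/-- If `A` is independent of `B₁ ⊔ B₂` and `B₁` of `B₂`, then `A ⊔ B₁` is independent of `B₂`. -/
lemma indep_sup_left [IsProbabilityMeasure P] {A B₁ B₂ : MeasurableSpace Ω}
    (hA : A ≤ mΩ) (hB₁ : B₁ ≤ mΩ) (hB₂ : B₂ ≤ mΩ)
    (h : Indep A (B₁ ⊔ B₂) P) (h' : Indep B₁ B₂ P) : Indep (A ⊔ B₁) B₂ P := by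
  refine IndepSets.indep (sup_le hA hB₁) hB₂ (isPiSystem_inter_measurableSet A B₁)
    (@MeasurableSpace.isPiSystem_measurableSet _ B₂) (sup_eq_generateFrom_inter A B₁)
    (@MeasurableSpace.generateFrom_measurableSet _ B₂).symm ?_
  rw [IndepSets_iff]
  rintro _ t ⟨a, b, ha, hb, rfl⟩ ht
  rw [Indep_iff] at h h'
  have ht' : MeasurableSet[B₁ ⊔ B₂] t := le_sup_right (a := B₁) (b := B₂) _ ht
  have hb' : MeasurableSet[B₁ ⊔ B₂] b := le_sup_left (a := B₁) (b := B₂) _ hb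
  rw [Set.inter_assoc, h _ _ ha (hb'.inter ht'), h' _ _ hb ht, h _ _ ha hb', mul_assoc]

/-- An integrable function whose integral vanishes on all sets `A ∩ B` has vanishing integral
over every set of the generated σ-algebra. -/
lemma setIntegral_eq_zero_of_sup {F G : MeasurableSpace Ω} (hF : F ≤ mΩ) (hG : G ≤ mΩ)
    {h : Ω → ℂ} (hi : Integrable h P)
    (H : ∀ A B, MeasurableSet[F] A → MeasurableSet[G] B → ∫ ω in A ∩ B, h ω ∂P = 0)
    {D : Set Ω} (hD : MeasurableSet[F ⊔ G] D) : ∫ ω in D, h ω ∂P = 0 := by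
  have hle : F ⊔ G ≤ mΩ := sup_le hF hG
  induction D, hD using MeasurableSpace.induction_on_inter
    (sup_eq_generateFrom_inter F G) (isPiSystem_inter_measurableSet F G) with
  | empty => simp
  | basic t ht =>
    obtain ⟨A, B, hA, hB, rfl⟩ := ht
    exact H A B hA hB
  | compl t ht ih =>
    have huniv := H Set.univ Set.univ .univ .univ
    rw [Set.univ_inter, Measure.restrict_univ] at huniv
    have := integral_add_compl (hle _ ht) hi
    rwa [ih, zero_add, huniv] at this
  | iUnion f hd hm ih =>
    rw [integral_iUnion (fun i => hle _ (hm i)) hd hi.integrableOn]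
    simp [ih]

/-- Freezing lemma: an identity of set integrals that holds for every constant parameter `c`
holds for `F`-measurable random parameters. -/
lemma setIntegral_freeze {Ω : Type*} {F mΩ : MeasurableSpace Ω} {P : Measure Ω}
    [IsFiniteMeasure P] {T : Type*} [PseudoEMetricSpace T]
    [SecondCountableTopology T]
    [MeasurableSpace T] [OpensMeasurableSpace T] (hF : F ≤ mΩ)
    {K : Set T} {Ψ₁ Ψ₂ : T → Ω → ℂ} {B : ℝ}
    (hc₁ : ∀ ω, Continuous fun c => Ψ₁ c ω) (hc₂ : ∀ ω, Continuous fun c => Ψ₂ c ω)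
    (hm₁ : ∀ c : Ω → T, Measurable c → AEStronglyMeasurable (fun ω => Ψ₁ (c ω) ω) P)
    (hm₂ : ∀ c : Ω → T, Measurable c → AEStronglyMeasurable (fun ω => Ψ₂ (c ω) ω) P)
    (hb₁ : ∀ᵐ ω ∂P, ∀ c ∈ K, ‖Ψ₁ c ω‖ ≤ B) (hb₂ : ∀ᵐ ω ∂P, ∀ c ∈ K, ‖Ψ₂ c ω‖ ≤ B)
    (H : ∀ c ∈ K, ∀ A, MeasurableSet[F] A → ∫ ω in A, Ψ₁ c ω ∂P = ∫ ω in A, Ψ₂ c ω ∂P)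
    {c : Ω → T} (hc : Measurable[F] c) (hcK : ∀ ω, c ω ∈ K)
    {A : Set Ω} (hA : MeasurableSet[F] A) :
    ∫ ω in A, Ψ₁ (c ω) ω ∂P = ∫ ω in A, Ψ₂ (c ω) ω ∂P := by
  classical
  rcases isEmpty_or_nonempty Ω with hΩ | ⟨⟨ω₀⟩⟩
  · simp [Set.eq_empty_of_isEmpty A]
  -- Approximate `c` by `F`-measurable simple functions. Their values stay in `K`, the only place
  -- where the bounds and the identity are assumed, and their fibres cut `A` into sets of `F`, on
  -- which the parameter is constant.
  let g : ℕ → @SimpleFunc Ω F T := fun N =>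
    @SimpleFunc.approxOn T Ω _ _ _ F c hc K (c ω₀) (hcK ω₀) _ N
  have hgK : ∀ N ω, g N ω ∈ K := fun N ω =>
    @SimpleFunc.approxOn_mem T Ω _ _ _ F c hc K (c ω₀) (hcK ω₀) _ N ω
  have hglim : ∀ ω, Filter.Tendsto (fun N => g N ω) Filter.atTop (nhds (c ω)) := fun ω =>
    @SimpleFunc.tendsto_approxOn T Ω _ _ _ F c hc K (c ω₀) (hcK ω₀) _ ω (subset_closure (hcK ω))
  have hgm : ∀ N, Measurable (g N) := fun N => (@SimpleFunc.measurable Ω T F _ (g N)).mono hF le_rfl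
  have hpiece : ∀ (Ψ : T → Ω → ℂ),
      (∀ c : Ω → T, Measurable c → AEStronglyMeasurable (fun ω => Ψ (c ω) ω) P) →
      (∀ᵐ ω ∂P, ∀ c ∈ K, ‖Ψ c ω‖ ≤ B) → ∀ N,
      ∫ ω in A, Ψ (g N ω) ω ∂P =
        ∑ y ∈ @SimpleFunc.range Ω T F (g N), ∫ ω in A ∩ g N ⁻¹' {y}, Ψ y ω ∂P := by
    intro Ψ hm hb N
    have hfib : ∀ y, MeasurableSet (A ∩ g N ⁻¹' {y}) := fun y =>
      hF _ (hA.inter (@SimpleFunc.measurableSet_fiber Ω T F (g N) y))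
    have hAeq : A = ⋃ y ∈ @SimpleFunc.range Ω T F (g N), A ∩ g N ⁻¹' {y} := by
      ext ω
      simp
    conv_lhs => rw [hAeq]
    rw [integral_biUnion_finset _ (fun y _ => hfib y)]
    · refine Finset.sum_congr rfl fun y _ => setIntegral_congr_fun (hfib y) ?_
      rintro ω ⟨-, hω⟩
      simp only [Set.mem_preimage, Set.mem_singleton_iff] at hω
      simp only [hω]
    · intro y _ y' _ hyy'
      refine Set.disjoint_left.2 ?_
      rintro ω ⟨-, h1⟩ ⟨-, h2⟩
      exact hyy' (h1.symm.trans h2)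
    · intro y _
      refine (Integrable.of_bound (hm _ (hgm N)) B ?_).integrableOn
      filter_upwards [hb] with ω hω using hω _ (hgK N ω)
  have hstep : ∀ N, ∫ ω in A, Ψ₁ (g N ω) ω ∂P = ∫ ω in A, Ψ₂ (g N ω) ω ∂P := by
    intro N
    rw [hpiece Ψ₁ hm₁ hb₁, hpiece Ψ₂ hm₂ hb₂]
    refine Finset.sum_congr rfl fun y hy => H y ?_ _
      (hA.inter (@SimpleFunc.measurableSet_fiber Ω T F (g N) y))
    obtain ⟨ω, rfl⟩ := (@SimpleFunc.mem_range Ω T F (g N) y).1 hy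
    exact hgK N ω
  have hlim : ∀ (Ψ : T → Ω → ℂ), (∀ ω, Continuous fun c => Ψ c ω) →
      (∀ c : Ω → T, Measurable c → AEStronglyMeasurable (fun ω => Ψ (c ω) ω) P) →
      (∀ᵐ ω ∂P, ∀ c ∈ K, ‖Ψ c ω‖ ≤ B) →
      Filter.Tendsto (fun N => ∫ ω in A, Ψ (g N ω) ω ∂P) Filter.atTop
        (nhds (∫ ω in A, Ψ (c ω) ω ∂P)) := by
    intro Ψ hc hm hb
    refine tendsto_integral_of_dominated_convergence (fun _ => B) (fun N => (hm _ (hgm N)).restrict)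
      (integrable_const _) (fun N => ae_restrict_of_ae ?_) (ae_of_all _ fun ω => ?_)
    · filter_upwards [hb] with ω hω using hω _ (hgK N ω)
    · exact ((hc ω).tendsto _).comp (hglim ω)
  have h1 := hlim Ψ₁ hc₁ hm₁ hb₁
  simp_rw [hstep] at h1
  exact tendsto_nhds_unique h1 (hlim Ψ₂ hc₂ hm₂ hb₂)

/-- Finite measures on `ℝ^ι` with the same characteristic function are equal. -/
lemma measure_ext_of_dotProduct {ι : Type*} [Fintype ι] {μ ν : Measure (ι → ℝ)}
    [IsFiniteMeasure μ] [IsFiniteMeasure ν]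
    (h : ∀ t : ι → ℝ, ∫ x, Complex.exp ((t ⬝ᵥ x : ℝ) * Complex.I) ∂μ =
      ∫ x, Complex.exp ((t ⬝ᵥ x : ℝ) * Complex.I) ∂ν) : μ = ν := by
  have key : μ.map (WithLp.toLp 2) = ν.map (WithLp.toLp 2) := by
    refine Measure.ext_of_charFun (E := EuclideanSpace ℝ ι) (funext fun t => ?_)
    simp only [charFun_apply]
    rw [integral_map (by fun_prop) (by fun_prop), integral_map (by fun_prop) (by fun_prop)]
    simpa [EuclideanSpace.inner_eq_star_dotProduct] using h t.ofLp
  have := congrArg (Measure.map (WithLp.ofLp : EuclideanSpace ℝ ι → (ι → ℝ))) key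
  rw [Measure.map_map (by fun_prop) (by fun_prop), Measure.map_map (by fun_prop) (by fun_prop)]
    at this
  simpa [Function.comp_def] using this

lemma charFun_normalLaw {ι : Type} [Fintype ι] [DecidableEq ι] {S : Matrix ι ι ℝ}
    (hS : S.PosSemidef) (μ t : ι → ℝ) :
    ∫ x, Complex.exp ((t ⬝ᵥ x : ℝ) * Complex.I) ∂(normalLaw μ S) =
      Complex.exp ((t ⬝ᵥ μ : ℝ) * Complex.I + ((-(t ⬝ᵥ S *ᵥ t) / 2 : ℝ) : ℂ)) := by
  have h := charFun_multivariateGaussian (μ := WithLp.toLp 2 μ) hS (WithLp.toLp 2 t)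
  rw [charFun_apply] at h
  rw [normalLaw, integral_map (by fun_prop) (by fun_prop)]
  simp only [EuclideanSpace.inner_eq_star_dotProduct] at h
  simp only [star_trivial] at h
  rw [h]
  rw [dotProduct_comm t μ]
  congr 1
  push_cast
  ring

/-- A bounded real density whose Fourier transform along `ν` vanishes integrates to zero over
all sets of `σ(ν)`. -/
lemma setIntegral_eq_zero_of_fourier_real {ι : Type*} [Fintype ι] [IsFiniteMeasure P]
    {ν : Ω → ι → ℝ} (hν : Measurable ν) {g : Ω → ℝ} (hg : Measurable g) {B : ℝ}
    (hB : ∀ᵐ ω ∂P, |g ω| ≤ B)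
    (H : ∀ s : ι → ℝ, ∫ ω, Complex.exp ((s ⬝ᵥ ν ω : ℝ) * Complex.I) * g ω ∂P = 0)
    {D : Set (ι → ℝ)} (hD : MeasurableSet D) : ∫ ω in ν ⁻¹' D, g ω ∂P = 0 := by
  -- Shifting by the bound `B` makes the density nonnegative. The measures with densities `g + B`
  -- and `B` have the same Fourier transform along `ν`, so their images under `ν` coincide.
  let m₁ : Measure Ω := P.withDensity fun ω => ((g ω + B).toNNReal : ENNReal)
  let m₂ : Measure Ω := P.withDensity fun _ => (B.toNNReal : ENNReal)
  have hnn₁ : ∀ᵐ ω ∂P, ((g ω + B).toNNReal : ℝ) = g ω + B := by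
    filter_upwards [hB] with ω hω
    exact Real.coe_toNNReal _ (by linarith [(abs_le.1 hω).1])
  have hnn₂ : ∀ᵐ ω ∂P, ((B.toNNReal : NNReal) : ℝ) = B := by
    filter_upwards [hB] with ω hω
    exact Real.coe_toNNReal _ ((abs_nonneg _).trans hω)
  have hgi : Integrable g P := Integrable.of_bound hg.aestronglyMeasurable B hB
  have hd₁ : Measurable fun ω => (g ω + B).toNNReal := by fun_prop
  have hfin₁ : IsFiniteMeasure m₁ := by
    refine isFiniteMeasure_withDensity ?_
    have : ∫⁻ ω, ((g ω + B).toNNReal : ENNReal) ∂P = ∫⁻ ω, ENNReal.ofReal (g ω + B) ∂P := rfl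
    rw [this]
    exact (hgi.add (integrable_const B)).lintegral_lt_top.ne
  have hfin₂ : IsFiniteMeasure m₂ := by
    refine isFiniteMeasure_withDensity ?_
    simp [ENNReal.mul_eq_top]
  have hmap : m₁.map ν = m₂.map ν := by
    refine measure_ext_of_dotProduct fun s => ?_
    rw [integral_map hν.aemeasurable (by fun_prop), integral_map hν.aemeasurable (by fun_prop),
      integral_withDensity_eq_integral_smul hd₁,
      integral_withDensity_eq_integral_smul measurable_const]
    have hi : Integrable (fun ω => Complex.exp ((s ⬝ᵥ ν ω : ℝ) * Complex.I)) P := by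
      refine Integrable.of_bound (C := 1) (by fun_prop) (ae_of_all _ fun ω => ?_)
      rw [Complex.norm_exp_ofReal_mul_I]
    have hi' : Integrable (fun ω => Complex.exp ((s ⬝ᵥ ν ω : ℝ) * Complex.I) * g ω) P := by
      refine Integrable.of_bound (C := B) (by fun_prop) ?_
      filter_upwards [hB] with ω hω
      rw [norm_mul, Complex.norm_exp_ofReal_mul_I, one_mul, Complex.norm_real]
      exact hω
    have e₁ : ∫ ω, (g ω + B).toNNReal • Complex.exp ((s ⬝ᵥ ν ω : ℝ) * Complex.I) ∂P =
        ∫ ω, (Complex.exp ((s ⬝ᵥ ν ω : ℝ) * Complex.I) * g ω +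
          B * Complex.exp ((s ⬝ᵥ ν ω : ℝ) * Complex.I)) ∂P := by
      refine integral_congr_ae ?_
      filter_upwards [hnn₁] with ω hω
      rw [NNReal.smul_def, hω, Complex.real_smul]
      push_cast
      ring
    have e₂ : ∫ ω, B.toNNReal • Complex.exp ((s ⬝ᵥ ν ω : ℝ) * Complex.I) ∂P =
        ∫ ω, B * Complex.exp ((s ⬝ᵥ ν ω : ℝ) * Complex.I) ∂P := by
      refine integral_congr_ae ?_
      filter_upwards [hnn₂] with ω hω
      rw [NNReal.smul_def, hω, Complex.real_smul]
    rw [e₁, e₂, integral_add hi' (hi.const_mul _), H, zero_add]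
  have hsets : ∫ _ in ν ⁻¹' D, (1 : ℝ) ∂m₁ = ∫ _ in ν ⁻¹' D, (1 : ℝ) ∂m₂ := by
    have := congrArg (fun m => m.real D) hmap
    simpa [map_measureReal_apply hν hD] using this
  have hr : ∀ f : Ω → ENNReal, (P.withDensity f).restrict (ν ⁻¹' D) =
      (P.restrict (ν ⁻¹' D)).withDensity f := fun f => restrict_withDensity (hν hD) f
  simp only [m₁, m₂, hr] at hsets
  rw [integral_withDensity_eq_integral_smul hd₁,
      integral_withDensity_eq_integral_smul measurable_const] at hsets
  have e₁ : ∫ ω in ν ⁻¹' D, (g ω + B).toNNReal • (1 : ℝ) ∂P = ∫ ω in ν ⁻¹' D, (g ω + B) ∂P := by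
    refine integral_congr_ae (ae_restrict_of_ae ?_)
    filter_upwards [hnn₁] with ω hω
    rw [NNReal.smul_def, hω, smul_eq_mul, mul_one]
  have e₂ : ∫ _ in ν ⁻¹' D, B.toNNReal • (1 : ℝ) ∂P = ∫ _ in ν ⁻¹' D, B ∂P := by
    refine integral_congr_ae (ae_restrict_of_ae ?_)
    filter_upwards [hnn₂] with ω hω
    rw [NNReal.smul_def, hω, smul_eq_mul, mul_one]
  rw [e₁, e₂, integral_add hgi.integrableOn (integrable_const _)] at hsets
  linarith

/-- A bounded complex density whose Fourier transform along `ν` vanishes integrates to zero over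
all sets of `σ(ν)`. -/
lemma setIntegral_eq_zero_of_fourier {ι : Type*} [Fintype ι] [IsFiniteMeasure P]
    {ν : Ω → ι → ℝ} (hν : Measurable ν) {h : Ω → ℂ} (hh : Measurable h) {B : ℝ}
    (hB : ∀ᵐ ω ∂P, ‖h ω‖ ≤ B)
    (H : ∀ s : ι → ℝ, ∫ ω, Complex.exp ((s ⬝ᵥ ν ω : ℝ) * Complex.I) * h ω ∂P = 0)
    {D : Set (ι → ℝ)} (hD : MeasurableSet D) : ∫ ω in ν ⁻¹' D, h ω ∂P = 0 := by
  have hi : ∀ s : ι → ℝ, Integrable (fun ω => Complex.exp ((s ⬝ᵥ ν ω : ℝ) * Complex.I) * h ω) P := by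
    intro s
    refine Integrable.of_bound (C := B) (by fun_prop) ?_
    filter_upwards [hB] with ω hω
    rwa [norm_mul, Complex.norm_exp_ofReal_mul_I, one_mul]
  have hi' : ∀ s : ι → ℝ, Integrable
      (fun ω => Complex.exp ((s ⬝ᵥ ν ω : ℝ) * Complex.I) * (starRingEnd ℂ) (h ω)) P := by
    intro s
    refine Integrable.of_bound (C := B) ?_ ?_
    · exact (by fun_prop : Measurable _).aestronglyMeasurable.mul
        (Complex.continuous_conj.measurable.comp hh).aestronglyMeasurable
    filter_upwards [hB] with ω hω
    rwa [norm_mul, Complex.norm_exp_ofReal_mul_I, one_mul, RCLike.norm_conj]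
  -- Conjugating the hypothesis at `-s` shows that the conjugate of `h` satisfies it too, and
  -- therefore so do the real and imaginary parts.
  have Hc : ∀ s : ι → ℝ,
      ∫ ω, Complex.exp ((s ⬝ᵥ ν ω : ℝ) * Complex.I) * (starRingEnd ℂ) (h ω) ∂P = 0 := by
    intro s
    have := congrArg (starRingEnd ℂ) (H (-s))
    rw [← integral_conj, map_zero] at this
    rw [← this]
    refine integral_congr_ae (ae_of_all _ fun ω => ?_)
    simp [← Complex.exp_conj]
  have hre : ∫ ω in ν ⁻¹' D, (h ω).re ∂P = 0 := by
    refine setIntegral_eq_zero_of_fourier_real hν (Complex.measurable_re.comp hh) (B := B) ?_ (fun s => ?_) hD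
    · filter_upwards [hB] with ω hω using (Complex.abs_re_le_norm _).trans hω
    · have : ∀ ω, Complex.exp ((s ⬝ᵥ ν ω : ℝ) * Complex.I) * ((h ω).re : ℂ) =
          (1 / 2 : ℂ) * (Complex.exp ((s ⬝ᵥ ν ω : ℝ) * Complex.I) * h ω +
            Complex.exp ((s ⬝ᵥ ν ω : ℝ) * Complex.I) * (starRingEnd ℂ) (h ω)) := by
        intro ω
        rw [Complex.re_eq_add_conj]
        ring
      refine (integral_congr_ae (ae_of_all _ this)).trans ?_
      rw [integral_const_mul, integral_add (hi s) (hi' s), H, Hc]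
      simp
  have him : ∫ ω in ν ⁻¹' D, (h ω).im ∂P = 0 := by
    refine setIntegral_eq_zero_of_fourier_real hν (Complex.measurable_im.comp hh) (B := B) ?_ (fun s => ?_) hD
    · filter_upwards [hB] with ω hω using (Complex.abs_im_le_norm _).trans hω
    · have : ∀ ω, Complex.exp ((s ⬝ᵥ ν ω : ℝ) * Complex.I) * ((h ω).im : ℂ) =
          (1 / (2 * Complex.I) : ℂ) * (Complex.exp ((s ⬝ᵥ ν ω : ℝ) * Complex.I) * h ω -
            Complex.exp ((s ⬝ᵥ ν ω : ℝ) * Complex.I) * (starRingEnd ℂ) (h ω)) := by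
        intro ω
        rw [Complex.im_eq_sub_conj]
        ring
      refine (integral_congr_ae (ae_of_all _ this)).trans ?_
      rw [integral_const_mul, integral_sub (hi s) (hi' s), H, Hc]
      simp
  have hint : Integrable h P := Integrable.of_bound hh.aestronglyMeasurable B hB
  rw [← integral_re_add_im hint.integrableOn]
  simp only [RCLike.re_eq_complex_re, RCLike.im_eq_complex_im] at *
  rw [hre, him]
  simp

end Generic

/-! ### Measurability of matrix operations -/

instance matrixMeasurableSpace {ι κ : Type*} : MeasurableSpace (Matrix ι κ ℝ) :=
  inferInstanceAs (MeasurableSpace (ι → κ → ℝ))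

section MatrixMeasurability

variable {α : Type*} {mα : MeasurableSpace α} {ι κ τ : Type*}

lemma measurable_matrix_iff {M : α → Matrix ι κ ℝ} :
    Measurable M ↔ ∀ i j, Measurable fun a => M a i j := by
  refine ⟨fun h i j => ?_, fun h => ?_⟩
  · exact (measurable_pi_apply j).comp ((measurable_pi_apply i).comp h)
  · exact measurable_pi_lambda _ fun i => measurable_pi_lambda _ fun j => h i j

lemma measurable_dotProduct [Fintype κ] {v w : α → κ → ℝ} (hv : Measurable v) (hw : Measurable w) :
    Measurable fun a => v a ⬝ᵥ w a := by
  simp only [dotProduct]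
  fun_prop

lemma measurable_mulVec [Fintype κ] {M : α → Matrix ι κ ℝ} {v : α → κ → ℝ}
    (hM : Measurable M) (hv : Measurable v) : Measurable fun a => M a *ᵥ v a := by
  refine measurable_pi_lambda _ fun i => measurable_dotProduct ?_ hv
  exact (measurable_pi_apply i).comp hM

lemma measurable_matrix_mul [Fintype κ] {M : α → Matrix ι κ ℝ} {N : α → Matrix κ τ ℝ}
    (hM : Measurable M) (hN : Measurable N) : Measurable fun a => M a * N a := by
  rw [measurable_matrix_iff] at *
  intro i j
  simp only [Matrix.mul_apply]
  exact Finset.measurable_sum _ fun l _ => (hM i l).mul (hN l j)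

lemma measurable_matrix_transpose {M : α → Matrix ι κ ℝ}
    (hM : Measurable M) : Measurable fun a => (M a)ᵀ := by
  rw [measurable_matrix_iff] at *
  exact fun i j => hM j i

lemma measurable_matrix_add {M N : α → Matrix ι κ ℝ}
    (hM : Measurable M) (hN : Measurable N) : Measurable fun a => M a + N a := by
  rw [measurable_matrix_iff] at *
  exact fun i j => (hM i j).add (hN i j)

lemma measurable_matrix_sub {M N : α → Matrix ι κ ℝ}
    (hM : Measurable M) (hN : Measurable N) : Measurable fun a => M a - N a := by
  rw [measurable_matrix_iff] at *
  exact fun i j => (hM i j).sub (hN i j)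

lemma measurable_fromBlocks {κ' ι' : Type*} {A : α → Matrix ι κ ℝ} {B : α → Matrix ι κ' ℝ}
    {C : α → Matrix ι' κ ℝ} {D : α → Matrix ι' κ' ℝ}
    (hA : Measurable A) (hB : Measurable B) (hC : Measurable C) (hD : Measurable D) :
    Measurable fun a => Matrix.fromBlocks (A a) (B a) (C a) (D a) := by
  rw [measurable_matrix_iff] at *
  rintro (i | i) (j | j) <;> simp [hA, hB, hC, hD]

lemma measurable_matrix_det [Fintype κ] [DecidableEq κ] {M : α → Matrix κ κ ℝ} (hM : Measurable M) :
    Measurable fun a => (M a).det := by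
  rw [measurable_matrix_iff] at hM
  simp only [Matrix.det_apply]
  exact Finset.measurable_sum _ fun σ _ =>
    (Finset.measurable_prod _ fun i _ => hM _ _).const_smul _

/-- The formula through determinant and adjugate also covers singular matrices, where the inverse is
zero by convention, so no invertibility is needed. -/
lemma measurable_matrix_inv [Fintype κ] [DecidableEq κ] {M : α → Matrix κ κ ℝ} (hM : Measurable M) :
    Measurable fun a => (M a)⁻¹ := by
  rw [measurable_matrix_iff]
  intro i j
  simp only [Matrix.inv_def, Ring.inverse_eq_inv', Matrix.smul_apply, smul_eq_mul,
    Matrix.adjugate_apply]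
  refine (measurable_matrix_det hM).inv.mul (measurable_matrix_det ?_)
  rw [measurable_matrix_iff] at *
  intro k l
  by_cases hk : k = j
  · subst hk
    simp
  · simpa [Matrix.updateRow_ne hk] using hM k l

end MatrixMeasurability

/-! ### Conditional normality and its calculus -/

/-- Conditionally on the σ-algebra `F`, the vector `e` has the distribution `𝒩(0, S)` with an
`F`-measurable covariance matrix `S`. -/
structure CondNormal {Ω : Type*} (F : MeasurableSpace Ω) [mΩ : MeasurableSpace Ω] (P : Measure Ω)
    {ι : Type*} [Fintype ι] (e : Ω → ι → ℝ) (S : Ω → Matrix ι ι ℝ) : Prop where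
  le : F ≤ mΩ
  measurable : Measurable e
  measurable_cov : Measurable[F] S
  posSemidef : ∀ᵐ ω ∂P, (S ω).PosSemidef
  charFun : ∀ A, MeasurableSet[F] A → ∀ t : ι → ℝ,
    ∫ ω in A, Complex.exp ((t ⬝ᵥ e ω : ℝ) * Complex.I) ∂P =
      ∫ ω in A, Complex.exp ((-(t ⬝ᵥ S ω *ᵥ t) / 2 : ℝ) : ℂ) ∂P

namespace CondNormal

variable {Ω : Type*} {F mΩ : MeasurableSpace Ω} {P : Measure Ω}
  {ι κ : Type*} [Fintype ι] [Fintype κ] {e : Ω → ι → ℝ} {S : Ω → Matrix ι ι ℝ}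

lemma quadForm_nonneg {S : Matrix ι ι ℝ} (hS : S.PosSemidef) (t : ι → ℝ) :
    0 ≤ t ⬝ᵥ S *ᵥ t := by
  simpa using hS.dotProduct_mulVec_nonneg t

lemma exp_quadForm_le_one {S : Matrix ι ι ℝ} (hS : S.PosSemidef) (t : ι → ℝ) :
    Real.exp (-(t ⬝ᵥ S *ᵥ t) / 2) ≤ 1 := by
  rw [Real.exp_le_one_iff]
  linarith [quadForm_nonneg hS t]

lemma norm_exp_quadForm_le {S : Matrix ι ι ℝ} (hS : S.PosSemidef) (t : ι → ℝ) :
    ‖Complex.exp ((-(t ⬝ᵥ S *ᵥ t) / 2 : ℝ) : ℂ)‖ ≤ 1 := by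
  rw [← Complex.ofReal_exp, Complex.norm_real, Real.norm_eq_abs, abs_of_pos (Real.exp_pos _)]
  exact exp_quadForm_le_one hS t

/-- The characteristic function identity for random `F`-measurable arguments and weights. -/
lemma setIntegral_exp [IsProbabilityMeasure P] (h : CondNormal F P e S) {t : Ω → ι → ℝ} (ht : Measurable[F] t)
    {f : Ω → ℝ} (hf : Measurable[F] f) (hf01 : ∀ ω, f ω ∈ Set.Icc (0 : ℝ) 1)
    {A : Set Ω} (hA : MeasurableSet[F] A) :
    ∫ ω in A, (f ω : ℂ) * Complex.exp ((t ω ⬝ᵥ e ω : ℝ) * Complex.I) ∂P =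
      ∫ ω in A, (f ω : ℂ) * Complex.exp ((-(t ω ⬝ᵥ S ω *ᵥ t ω) / 2 : ℝ) : ℂ) ∂P := by
  have hS : Measurable S := h.measurable_cov.mono h.le le_rfl
  have he := h.measurable
  have hw : ∀ {z : ℂ} {c : ℝ}, c ∈ Set.Icc (0 : ℝ) 1 → ‖z‖ ≤ 1 → ‖(c : ℂ) * z‖ ≤ 1 := by
    intro z c hc hz
    rw [norm_mul, Complex.norm_real, Real.norm_eq_abs, abs_of_nonneg hc.1]
    exact mul_le_one₀ hc.2 (norm_nonneg _) hz
  -- Weight and argument are frozen together; confining the weight to `[0, 1]` bounds both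
  -- integrands by `1`.
  refine setIntegral_freeze (T := ℝ × (ι → ℝ)) (K := Set.Icc 0 1 ×ˢ Set.univ) h.le
    (Ψ₁ := fun c ω => (c.1 : ℂ) * Complex.exp ((c.2 ⬝ᵥ e ω : ℝ) * Complex.I))
    (Ψ₂ := fun c ω => (c.1 : ℂ) * Complex.exp ((-(c.2 ⬝ᵥ S ω *ᵥ c.2) / 2 : ℝ) : ℂ))
    (c := fun ω => (f ω, t ω)) (B := 1) (fun ω => ?_) (fun ω => ?_) (fun c hc => ?_)
    (fun c hc => ?_) ?_ ?_ ?_ (hf.prodMk ht) (fun ω => ⟨hf01 ω, trivial⟩) hA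
  · have : Continuous fun c : ℝ × (ι → ℝ) => c.2 ⬝ᵥ e ω :=
      Continuous.dotProduct continuous_snd continuous_const
    fun_prop
  · have : Continuous fun c : ℝ × (ι → ℝ) => c.2 ⬝ᵥ S ω *ᵥ c.2 :=
      Continuous.dotProduct continuous_snd (Continuous.matrix_mulVec continuous_const continuous_snd)
    fun_prop
  · have := measurable_dotProduct hc.snd he
    exact Measurable.aestronglyMeasurable (by fun_prop)
  · have := measurable_dotProduct hc.snd (measurable_mulVec hS hc.snd)
    exact Measurable.aestronglyMeasurable (by fun_prop)
  · refine ae_of_all _ fun ω c hc => hw hc.1 ?_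
    rw [Complex.norm_exp_ofReal_mul_I]
  · filter_upwards [h.posSemidef] with ω hω c hc
    exact hw hc.1 (norm_exp_quadForm_le hω _)
  · intro c _ A hA
    rw [integral_const_mul, integral_const_mul, h.charFun A hA]

/-- Replacing the covariance by an almost everywhere equal one. -/
lemma congr_cov (h : CondNormal F P e S) {S' : Ω → Matrix ι ι ℝ} (hS' : Measurable[F] S')
    (heq : ∀ᵐ ω ∂P, S ω = S' ω) : CondNormal F P e S' where
  le := h.le
  measurable := h.measurable
  measurable_cov := hS'
  posSemidef := by filter_upwards [h.posSemidef, heq] with ω h1 h2 using h2 ▸ h1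
  charFun A hA t := by
    rw [h.charFun A hA t]
    refine integral_congr_ae (ae_restrict_of_ae ?_)
    filter_upwards [heq] with ω hω
    rw [hω]

/-- Linear images under an `F`-measurable random matrix. -/
lemma mulVec [IsProbabilityMeasure P] (h : CondNormal F P e S) {M : Ω → Matrix κ ι ℝ} (hM : Measurable[F] M) :
    CondNormal F P (fun ω => M ω *ᵥ e ω) (fun ω => M ω * S ω * (M ω)ᵀ) where
  le := h.le
  measurable := measurable_mulVec (hM.mono h.le le_rfl) h.measurable
  measurable_cov := measurable_matrix_mul (measurable_matrix_mul hM h.measurable_cov)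
    (measurable_matrix_transpose hM)
  posSemidef := by
    filter_upwards [h.posSemidef] with ω hω
    simpa using hω.mul_mul_conjTranspose_same (M ω)
  charFun A hA t := by
    -- Moving `M` to the other side of the dot product turns `t` into the random argument `Mᵀ t`.
    have := h.setIntegral_exp (t := fun ω => (M ω)ᵀ *ᵥ t) (f := fun _ => 1)
      (measurable_mulVec (measurable_matrix_transpose hM) measurable_const)
      measurable_const (fun _ => by simp) hA
    simp only [Complex.ofReal_one, one_mul] at this
    convert this using 6 with ω ω
    · rw [Matrix.mulVec_transpose, Matrix.dotProduct_mulVec]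
    · rw [Matrix.mulVec_transpose, Matrix.mul_assoc, ← Matrix.mulVec_mulVec,
        Matrix.dotProduct_mulVec, ← Matrix.mulVec_mulVec, Matrix.mulVec_transpose]

lemma sumElim_dotProduct (t : ι ⊕ κ → ℝ) (v : ι → ℝ) (w : κ → ℝ) :
    t ⬝ᵥ Sum.elim v w = (t ∘ Sum.inl) ⬝ᵥ v + (t ∘ Sum.inr) ⬝ᵥ w := by
  simp [dotProduct, Fintype.sum_sum_type]

lemma quadForm_blockDiag (t : ι ⊕ κ → ℝ) (A : Matrix ι ι ℝ) (B : Matrix κ κ ℝ) :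
    t ⬝ᵥ Matrix.fromBlocks A 0 0 B *ᵥ t =
      (t ∘ Sum.inl) ⬝ᵥ A *ᵥ (t ∘ Sum.inl) + (t ∘ Sum.inr) ⬝ᵥ B *ᵥ (t ∘ Sum.inr) := by
  rw [Matrix.fromBlocks_mulVec, sumElim_dotProduct]
  simp

lemma posSemidef_blockDiag {A : Matrix ι ι ℝ} {B : Matrix κ κ ℝ}
    (hA : A.PosSemidef) (hB : B.PosSemidef) : (Matrix.fromBlocks A 0 0 B).PosSemidef := by
  refine Matrix.PosSemidef.of_dotProduct_mulVec_nonneg ?_ fun x => ?_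
  · exact Matrix.IsHermitian.fromBlocks hA.1 (by simp) hB.1
  · rw [star_trivial, quadForm_blockDiag]
    exact add_nonneg (quadForm_nonneg hA _) (quadForm_nonneg hB _)

/-- Adjoining an independent normal vector. -/
lemma sumElim (h : CondNormal F P e S) {d : Ω → κ → ℝ} (hd : Measurable d)
    {Q : Matrix κ κ ℝ} (hQ : Q.PosSemidef)
    (hlaw : ∀ t : κ → ℝ, ∫ ω, Complex.exp ((t ⬝ᵥ d ω : ℝ) * Complex.I) ∂P =
      Complex.exp ((-(t ⬝ᵥ Q *ᵥ t) / 2 : ℝ) : ℂ))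
    (hind : Indep (F ⊔ MeasurableSpace.comap e inferInstance)
      (MeasurableSpace.comap d inferInstance) P) :
    CondNormal F P (fun ω => Sum.elim (e ω) (d ω)) (fun ω => Matrix.fromBlocks (S ω) 0 0 Q) where
  le := h.le
  measurable := by
    refine measurable_pi_lambda _ ?_
    rintro (i | j)
    · exact (measurable_pi_apply i).comp h.measurable
    · exact (measurable_pi_apply j).comp hd
  measurable_cov := measurable_fromBlocks h.measurable_cov measurable_const measurable_const
    measurable_const
  posSemidef := by
    filter_upwards [h.posSemidef] with ω hω using posSemidef_blockDiag hω hQ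
  charFun A hA t := by
    have hA' : MeasurableSet A := h.le _ hA
    set t₁ := t ∘ Sum.inl
    set t₂ := t ∘ Sum.inr
    -- The indicator of `A` goes into the factor depending on `F` and `e`, so that one use of
    -- independence splits the integral over `A`.
    let X : Ω → ℂ := A.indicator fun ω => Complex.exp ((t₁ ⬝ᵥ e ω : ℝ) * Complex.I)
    let Y : Ω → ℂ := fun ω => Complex.exp ((t₂ ⬝ᵥ d ω : ℝ) * Complex.I)
    have hX : Measurable[F ⊔ MeasurableSpace.comap e inferInstance] X := by
      refine Measurable.indicator ?_ (le_sup_left (a := F) _ hA)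
      have he : Measurable[F ⊔ MeasurableSpace.comap e inferInstance] e :=
        (comap_measurable e).mono le_sup_right le_rfl
      exact (by fun_prop : Measurable fun v : ι → ℝ =>
        Complex.exp ((t₁ ⬝ᵥ v : ℝ) * Complex.I)).comp he
    have hY : Measurable[MeasurableSpace.comap d inferInstance] Y :=
      (by fun_prop : Measurable fun v : κ → ℝ =>
        Complex.exp ((t₂ ⬝ᵥ v : ℝ) * Complex.I)).comp (comap_measurable d)
    have hXY : IndepFun X Y P := by
      rw [IndepFun_iff_Indep]
      exact indep_of_indep_of_le hind hX.comap_le hY.comap_le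
    have hXm : Measurable X :=
      hX.mono (sup_le h.le h.measurable.comap_le) le_rfl
    have hYm : Measurable Y := hY.mono hd.comap_le le_rfl
    have hprod := hXY.integral_fun_mul_eq_mul_integral hXm.aestronglyMeasurable
      hYm.aestronglyMeasurable
    have hXint : ∫ ω, X ω ∂P = ∫ ω in A, Complex.exp ((-(t₁ ⬝ᵥ S ω *ᵥ t₁) / 2 : ℝ) : ℂ) ∂P := by
      rw [integral_indicator hA', h.charFun A hA]
    rw [hXint, hlaw] at hprod
    rw [← integral_indicator hA']
    have e1 : ∀ ω, A.indicator (fun ω => Complex.exp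
        ((t ⬝ᵥ Sum.elim (e ω) (d ω) : ℝ) * Complex.I)) ω = X ω * Y ω := by
      intro ω
      by_cases hω : ω ∈ A
      · simp only [X, Y, Set.indicator_of_mem hω, sumElim_dotProduct]
        rw [← Complex.exp_add]
        congr 1
        push_cast
        ring
      · simp [X, Set.indicator_of_notMem hω]
    simp_rw [e1]
    rw [hprod, ← integral_mul_const]
    refine integral_congr_ae (ae_of_all _ fun ω => ?_)
    simp only [quadForm_blockDiag]
    rw [← Complex.exp_add]
    congr 1
    push_cast
    ring

/-- Time update: adding an independent normal vector. -/
lemma add_indep [IsProbabilityMeasure P] (h : CondNormal F P e S) {d : Ω → ι → ℝ} (hd : Measurable d)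
    {Q : Matrix ι ι ℝ} (hQ : Q.PosSemidef)
    (hlaw : ∀ t : ι → ℝ, ∫ ω, Complex.exp ((t ⬝ᵥ d ω : ℝ) * Complex.I) ∂P =
      Complex.exp ((-(t ⬝ᵥ Q *ᵥ t) / 2 : ℝ) : ℂ))
    (hind : Indep (F ⊔ MeasurableSpace.comap e inferInstance)
      (MeasurableSpace.comap d inferInstance) P) :
    CondNormal F P (fun ω => e ω + d ω) (fun ω => S ω + Q) := by
  classical
  -- The sum is the image of the stacked vector `(e, d)` under the matrix `[1 1]`.
  have h1 := (h.sumElim hd hQ hlaw hind).mulVec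
    (M := fun _ => Matrix.fromCols (1 : Matrix ι ι ℝ) (1 : Matrix ι ι ℝ)) measurable_const
  convert h1 using 2 with ω ω
  · simp
  · rw [Matrix.transpose_fromCols, Matrix.fromCols_mul_fromBlocks, Matrix.fromCols_mul_fromRows]
    simp

/-- Conditioning on a block that is conditionally uncorrelated with the rest. -/
lemma condition [IsProbabilityMeasure P] {ν : Ω → κ → ℝ} {T : Ω → Matrix κ κ ℝ}
    (h : CondNormal F P (fun ω => Sum.elim (ν ω) (e ω))
      (fun ω => Matrix.fromBlocks (T ω) 0 0 (S ω))) :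
    CondNormal (F ⊔ MeasurableSpace.comap ν inferInstance) P e S := by
  have hν : Measurable ν := measurable_pi_lambda _ fun i =>
    (measurable_pi_apply (Sum.inl i)).comp h.measurable
  have he : Measurable e := measurable_pi_lambda _ fun i =>
    (measurable_pi_apply (Sum.inr i)).comp h.measurable
  have hSm : Measurable[F] S := by
    rw [measurable_matrix_iff]
    intro i j
    simpa using measurable_matrix_iff.1 h.measurable_cov (Sum.inr i) (Sum.inr j)
  have hS : ∀ᵐ ω ∂P, (S ω).PosSemidef := by
    filter_upwards [h.posSemidef] with ω hω using hω.submatrix Sum.inr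
  have hSm' : Measurable S := hSm.mono h.le le_rfl
  refine ⟨sup_le h.le hν.comap_le, he, hSm.mono le_sup_left le_rfl, hS, fun D hD t => ?_⟩
  have hq : Measurable[F] fun ω => t ⬝ᵥ S ω *ᵥ t :=
    measurable_dotProduct measurable_const (measurable_mulVec hSm measurable_const)
  have hq' : Measurable fun ω => t ⬝ᵥ S ω *ᵥ t := hq.mono h.le le_rfl
  have hte := measurable_dotProduct (measurable_const (a := t)) he
  have i1 : Integrable (fun ω => Complex.exp ((t ⬝ᵥ e ω : ℝ) * Complex.I)) P := by
    refine Integrable.of_bound (C := 1) (Measurable.aestronglyMeasurable (by fun_prop))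
      (ae_of_all _ fun ω => ?_)
    rw [Complex.norm_exp_ofReal_mul_I]
  have i2 : Integrable (fun ω => Complex.exp ((-(t ⬝ᵥ S ω *ᵥ t) / 2 : ℝ) : ℂ)) P := by
    refine Integrable.of_bound (C := 1) (Measurable.aestronglyMeasurable (by fun_prop)) ?_
    filter_upwards [hS] with ω hω using norm_exp_quadForm_le hω t
  -- It suffices to test on sets `A ∩ ν⁻¹ B` with `A` in `F`. For fixed `A`, vanishing for all `B`
  -- follows from vanishing of the Fourier transform along `ν`.
  have key : ∫ ω in D, (Complex.exp ((t ⬝ᵥ e ω : ℝ) * Complex.I) -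
      Complex.exp ((-(t ⬝ᵥ S ω *ᵥ t) / 2 : ℝ) : ℂ)) ∂P = 0 := by
    refine setIntegral_eq_zero_of_sup h.le hν.comap_le (i1.sub i2) ?_ hD
    rintro A _ hA ⟨B, hB, rfl⟩
    have hrs : P.restrict (A ∩ ν ⁻¹' B) = (P.restrict A).restrict (ν ⁻¹' B) := by
      rw [Measure.restrict_restrict (hν hB), Set.inter_comm]
    rw [hrs]
    refine setIntegral_eq_zero_of_fourier hν (by fun_prop) (B := 2) ?_ (fun s => ?_) hB
    · refine ae_restrict_of_ae ?_
      filter_upwards [hS] with ω hω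
      refine (norm_sub_le _ _).trans ?_
      rw [Complex.norm_exp_ofReal_mul_I]
      linarith [norm_exp_quadForm_le hω t]
    · have hsν := measurable_dotProduct (measurable_const (a := s)) hν
      have j1 : Integrable (fun ω => Complex.exp ((s ⬝ᵥ ν ω : ℝ) * Complex.I) *
          Complex.exp ((t ⬝ᵥ e ω : ℝ) * Complex.I)) P := by
        refine Integrable.of_bound (C := 1) (Measurable.aestronglyMeasurable (by fun_prop))
          (ae_of_all _ fun ω => ?_)
        rw [norm_mul, Complex.norm_exp_ofReal_mul_I, Complex.norm_exp_ofReal_mul_I, one_mul]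
      have j2 : Integrable (fun ω => Complex.exp ((s ⬝ᵥ ν ω : ℝ) * Complex.I) *
          Complex.exp ((-(t ⬝ᵥ S ω *ᵥ t) / 2 : ℝ) : ℂ)) P := by
        refine Integrable.of_bound (C := 1) (Measurable.aestronglyMeasurable (by fun_prop)) ?_
        filter_upwards [hS] with ω hω
        rw [norm_mul, Complex.norm_exp_ofReal_mul_I, one_mul]
        exact norm_exp_quadForm_le hω t
      refine (integral_congr_ae (ae_of_all _ fun ω => mul_sub _ _ _)).trans ?_
      rw [integral_sub j1.integrableOn j2.integrableOn, sub_eq_zero]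
      -- By block-diagonality, the joint characteristic function at `(s, t)` splits into a factor
      -- for `T` and one for `S`. The `S` factor is `F`-measurable and serves as the weight in `k2`,
      -- which turns the `T` factor back into the exponential of `ν`. The `min` with `1` makes the
      -- weight bound hold everywhere, since `S` is positive semidefinite only almost everywhere.
      have k1 := h.charFun A hA (Sum.elim s t)
      have k2 := h.setIntegral_exp (t := fun _ => Sum.elim s 0)
        (f := fun ω => min 1 (Real.exp (-(t ⬝ᵥ S ω *ᵥ t) / 2))) measurable_const
        (by fun_prop) (fun ω => ⟨by positivity, min_le_left _ _⟩) hA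
      have hmin : ∀ᵐ ω ∂P, min 1 (Real.exp (-(t ⬝ᵥ S ω *ᵥ t) / 2)) =
          Real.exp (-(t ⬝ᵥ S ω *ᵥ t) / 2) := by
        filter_upwards [hS] with ω hω using min_eq_right (exp_quadForm_le_one hω t)
      calc ∫ ω in A, Complex.exp ((s ⬝ᵥ ν ω : ℝ) * Complex.I) *
            Complex.exp ((t ⬝ᵥ e ω : ℝ) * Complex.I) ∂P
          = ∫ ω in A, Complex.exp
              ((Sum.elim s t ⬝ᵥ Sum.elim (ν ω) (e ω) : ℝ) * Complex.I) ∂P := by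
            refine integral_congr_ae (ae_of_all _ fun ω => ?_)
            simp only [sumElim_dotProduct, Sum.elim_comp_inl, Sum.elim_comp_inr]
            rw [← Complex.exp_add]
            congr 1
            push_cast
            ring
        _ = _ := k1
        _ = ∫ ω in A, ((min 1 (Real.exp (-(t ⬝ᵥ S ω *ᵥ t) / 2)) : ℝ) : ℂ) *
              Complex.exp ((-((Sum.elim s 0 : κ ⊕ ι → ℝ) ⬝ᵥ
                Matrix.fromBlocks (T ω) 0 0 (S ω) *ᵥ Sum.elim s 0) / 2 : ℝ) : ℂ) ∂P := by
            refine integral_congr_ae (ae_restrict_of_ae ?_)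
            filter_upwards [hmin] with ω hω
            rw [hω]
            simp only [quadForm_blockDiag, Sum.elim_comp_inl, Sum.elim_comp_inr]
            rw [Complex.ofReal_exp, ← Complex.exp_add]
            congr 1
            simp
            ring
        _ = _ := k2.symm
        _ = _ := by
            refine integral_congr_ae (ae_restrict_of_ae ?_)
            filter_upwards [hmin] with ω hω
            rw [hω, Complex.ofReal_exp, mul_comm]
            simp
  rw [integral_sub i1.integrableOn i2.integrableOn] at key
  exact sub_eq_zero.1 key

end CondNormal

/-! ### Covariance algebra of the Kalman gain and measurable square roots -/

section LinearAlgebra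

variable {ι κ : Type*} [Fintype ι] [Fintype κ] [DecidableEq ι] [DecidableEq κ]

/-- The map `(e, w) ↦ (C e + w, e - K (C e + w))` with the Kalman gain `K` block-diagonalizes the
covariance matrix. -/
lemma kalman_blockDiag {S : Matrix ι ι ℝ} {Q : Matrix κ κ ℝ} (hS : Sᵀ = S) (hQ : Qᵀ = Q)
    (C : Matrix κ ι ℝ) (hT : IsUnit (C * S * Cᵀ + Q)) {K : Matrix ι κ ℝ}
    (hK : K = S * Cᵀ * (C * S * Cᵀ + Q)⁻¹) :
    Matrix.fromBlocks C 1 (1 - K * C) (-K) * Matrix.fromBlocks S 0 0 Q *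
      (Matrix.fromBlocks C 1 (1 - K * C) (-K))ᵀ =
    Matrix.fromBlocks (C * S * Cᵀ + Q) 0 0 (S - K * C * S) := by
  have hTs : (C * S * Cᵀ + Q)ᵀ = C * S * Cᵀ + Q := by
    simp [Matrix.transpose_mul, hS, hQ, Matrix.mul_assoc]
  have hdet : IsUnit (C * S * Cᵀ + Q).det := (Matrix.isUnit_iff_isUnit_det _).1 hT
  -- This normal equation says that the innovation and the updated error are uncorrelated. It is the
  -- only use of invertibility.
  have hKT : K * (C * S * Cᵀ + Q) = S * Cᵀ := by
    rw [hK, Matrix.mul_assoc, Matrix.nonsing_inv_mul _ hdet, Matrix.mul_one]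
  have hTK : (C * S * Cᵀ + Q) * Kᵀ = C * S := by
    have := congrArg Matrix.transpose hKT
    simpa only [Matrix.transpose_mul, hTs, hS, Matrix.transpose_transpose] using this
  have hKT' : K * (C * S * Cᵀ) = S * Cᵀ - K * Q := by
    rw [← hKT, Matrix.mul_add]
    abel
  have hTK' : C * S * Cᵀ * Kᵀ = C * S - Q * Kᵀ :=
    eq_sub_of_add_eq (by rw [← Matrix.add_mul, hTK])
  rw [Matrix.fromBlocks_transpose, Matrix.fromBlocks_multiply, Matrix.fromBlocks_multiply]
  simp only [Matrix.mul_zero, Matrix.one_mul, zero_add, add_zero, Matrix.transpose_one,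
    Matrix.mul_one, Matrix.transpose_sub, Matrix.transpose_neg, Matrix.transpose_mul]
  congr 1
  · rw [Matrix.mul_sub, Matrix.mul_one, ← Matrix.mul_assoc, hTK', Matrix.mul_neg]
    abel
  · rw [Matrix.sub_mul, Matrix.sub_mul, Matrix.one_mul, Matrix.mul_assoc K C S,
      Matrix.mul_assoc K (C * S), hKT', Matrix.neg_mul]
    abel
  -- The last block arises in Joseph form `(1 - K C) S (1 - K C)ᵀ + K Q Kᵀ`; this identity cancels
  -- all but `(1 - K C) S`.
  · have h1 : (1 - K * C) * S * Cᵀ = K * Q := by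
      rw [Matrix.sub_mul, Matrix.sub_mul, Matrix.one_mul, Matrix.mul_assoc K C S,
        Matrix.mul_assoc K (C * S), hKT']
      abel
    rw [Matrix.mul_sub, Matrix.mul_one, ← Matrix.mul_assoc, h1, Matrix.sub_mul, Matrix.one_mul]
    simp

/-- A measurable choice of symmetric square roots of positive semidefinite matrices. -/
lemma exists_measurable_sqrt (ι : Type*) [Fintype ι] [DecidableEq ι] :
    ∃ R : Matrix ι ι ℝ → Matrix ι ι ℝ, Measurable R ∧
      ∀ A, A.PosSemidef → (R A)ᵀ = R A ∧ R A * R A = A := by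
  classical
  -- The square root is continuous on the closed cone of positive semidefinite matrices, so its
  -- extension by zero is measurable.
  open scoped MatrixOrder Matrix.Norms.L2Operator in
  have hcont : ContinuousOn (CFC.sqrt : Matrix ι ι ℝ → Matrix ι ι ℝ) {A | 0 ≤ A} :=
    CFC.continuousOn_sqrt
  have : BorelSpace (Matrix ι ι ℝ) := inferInstanceAs (BorelSpace (ι → ι → ℝ))
  open scoped MatrixOrder in
  have hclosed : IsClosed {A : Matrix ι ι ℝ | 0 ≤ A} := by
    have : {A : Matrix ι ι ℝ | 0 ≤ A} = {A | Aᵀ = A} ∩ ⋂ x : ι → ℝ, {A | 0 ≤ x ⬝ᵥ A *ᵥ x} := by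
      ext A
      simp [Matrix.nonneg_iff_posSemidef, Matrix.posSemidef_iff_dotProduct_mulVec,
        Matrix.IsHermitian]
    rw [this]
    refine (isClosed_eq (by fun_prop) continuous_id).inter (isClosed_iInter fun x => ?_)
    exact isClosed_le continuous_const
      (Continuous.dotProduct continuous_const (Continuous.matrix_mulVec continuous_id continuous_const))
  open scoped MatrixOrder in
  refine ⟨Set.piecewise {A | 0 ≤ A} CFC.sqrt 0, hcont.measurable_piecewise
    continuousOn_const hclosed.measurableSet, fun A hA => ?_⟩
  open scoped MatrixOrder in
  have hA' : A ∈ {A : Matrix ι ι ℝ | 0 ≤ A} := hA.nonneg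
  rw [Set.piecewise_eq_of_mem _ _ _ hA']
  open scoped MatrixOrder in
  refine ⟨?_, CFC.sqrt_mul_sqrt_self A hA'⟩
  open scoped MatrixOrder in
  simpa [Matrix.IsSymm] using (Matrix.nonneg_iff_posSemidef.1 (CFC.sqrt_nonneg A)).1

end LinearAlgebra

/-! ### Quantiles and the χ² distribution -/

section Quantile

/-- Right-continuity of the distribution function gives it a value of at least `1 - α` at the
quantile itself. Positivity of `α` ensures that the level is reached somewhere. -/
lemma measure_Ioi_quantile_le (μ : Measure ℝ) [IsProbabilityMeasure μ] {α : ℝ}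
    (hα₀ : 0 < α) : μ (Set.Ioi (quantile μ (1 - α))) ≤ ENNReal.ofReal α := by
  set q := quantile μ (1 - α) with hq
  set A := {t : ℝ | 1 - α ≤ cdf μ t} with hA
  have hne : A.Nonempty := by
    have := (tendsto_cdf_atTop μ).eventually (lt_mem_nhds (by linarith : 1 - α < 1))
    obtain ⟨t, ht⟩ := this.exists
    exact ⟨t, ht.le⟩
  have hqcdf : 1 - α ≤ cdf μ q := by
    have hright : Filter.Tendsto (cdf μ) (nhdsWithin q (Set.Ioi q)) (nhds (cdf μ q)) :=
      ((cdf μ).right_continuous q).tendsto.mono_left (nhdsWithin_mono _ Set.Ioi_subset_Ici_self)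
    refine ge_of_tendsto hright ?_
    filter_upwards [self_mem_nhdsWithin] with t ht
    obtain ⟨s, hs, hst⟩ := exists_lt_of_csInf_lt hne (show sInf A < t from ht)
    exact le_trans hs (monotone_cdf μ hst.le)
  have hcompl : Set.Ioi q = (Set.Iic q)ᶜ := Set.compl_Iic.symm
  rw [cdf_eq_real] at hqcdf
  rw [hcompl, ← ofReal_measureReal, probReal_compl_eq_one_sub measurableSet_Iic]
  exact ENNReal.ofReal_le_ofReal (by linarith)

lemma isProbabilityMeasure_chiSquared (d : ℕ) : IsProbabilityMeasure (chiSquared d) :=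
  Measure.isProbabilityMeasure_map
    (by fun_prop : Measurable fun g : Fin d → ℝ => ∑ i, g i ^ 2).aemeasurable

/-- A product of identical factors is invariant under relabelling; this is needed because parameters
are indexed by `ParamIdx n m`. -/
lemma chiSquared_eq_map {ι : Type*} [Fintype ι] {d : ℕ} (hd : Fintype.card ι = d) :
    chiSquared d =
      (Measure.pi fun _ : ι => gaussianReal 0 1).map fun g => ∑ i, g i ^ 2 := by
  let f : Fin d ≃ ι := (Fintype.equivFinOfCardEq hd).symm
  have hmp := measurePreserving_piCongrLeft (fun _ : ι => gaussianReal 0 1) f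
  rw [← hmp.map_eq, Measure.map_map (by fun_prop) (MeasurableEquiv.measurable _), chiSquared]
  congr 1
  funext g
  simp only [Function.comp_apply]
  rw [← Equiv.sum_comp f]
  simp [MeasurableEquiv.piCongrLeft, Equiv.piCongrLeft_apply_apply]

end Quantile

/-! ### Measurement update and Mahalanobis norm of conditionally normal vectors -/

namespace CondNormal

variable {Ω : Type*} {F mΩ : MeasurableSpace Ω} {P : Measure Ω} [IsProbabilityMeasure P]
  {ι κ : Type*} [Fintype ι] [Fintype κ] [DecidableEq ι] [DecidableEq κ]
  {e : Ω → ι → ℝ} {S : Ω → Matrix ι ι ℝ}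

/-- Measurement update: conditioning on the innovation `C e + w`. -/
lemma correct (h : CondNormal F P e S) {C : Ω → Matrix κ ι ℝ} (hC : Measurable[F] C)
    {w : Ω → κ → ℝ} (hw : Measurable w) {Q : Matrix κ κ ℝ} (hQ : Q.PosSemidef)
    (hlaw : ∀ t : κ → ℝ, ∫ ω, Complex.exp ((t ⬝ᵥ w ω : ℝ) * Complex.I) ∂P =
      Complex.exp ((-(t ⬝ᵥ Q *ᵥ t) / 2 : ℝ) : ℂ))
    (hind : Indep (F ⊔ MeasurableSpace.comap e inferInstance)
      (MeasurableSpace.comap w inferInstance) P)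
    {K : Ω → Matrix ι κ ℝ}
    (hK : ∀ ω, K ω = S ω * (C ω)ᵀ * (C ω * S ω * (C ω)ᵀ + Q)⁻¹)
    (hunit : ∀ᵐ ω ∂P, IsUnit (C ω * S ω * (C ω)ᵀ + Q)) :
    CondNormal (F ⊔ MeasurableSpace.comap (fun ω => C ω *ᵥ e ω + w ω) inferInstance) P
      (fun ω => e ω - K ω *ᵥ (C ω *ᵥ e ω + w ω)) (fun ω => S ω - K ω * C ω * S ω) := by
  have hSm := h.measurable_cov
  have hTm : Measurable[F] fun ω => C ω * S ω * (C ω)ᵀ + Q :=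
    measurable_matrix_add (measurable_matrix_mul (measurable_matrix_mul hC hSm)
      (measurable_matrix_transpose hC)) measurable_const
  have hKm : Measurable[F] K := by
    have : K = fun ω => S ω * (C ω)ᵀ * (C ω * S ω * (C ω)ᵀ + Q)⁻¹ := funext hK
    rw [this]
    exact measurable_matrix_mul (measurable_matrix_mul hSm (measurable_matrix_transpose hC))
      (measurable_matrix_inv hTm)
  have hKC := measurable_matrix_mul hKm hC
  have hM : Measurable[F] fun ω =>
      Matrix.fromBlocks (C ω) (1 : Matrix κ κ ℝ) (1 - K ω * C ω) (-K ω) := by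
    refine measurable_fromBlocks hC measurable_const
      (measurable_matrix_sub measurable_const hKC) ?_
    simpa using measurable_matrix_sub (measurable_const (a := (0 : Matrix ι κ ℝ))) hKm
  have h1 := (h.sumElim hw hQ hlaw hind).mulVec hM
  -- Block-diagonality is available only where the innovation covariance is invertible, hence the
  -- almost everywhere replacement.
  have h2 := h1.congr_cov (S' := fun ω =>
      Matrix.fromBlocks (C ω * S ω * (C ω)ᵀ + Q) 0 0 (S ω - K ω * C ω * S ω))
    (measurable_fromBlocks hTm measurable_const measurable_const
      (measurable_matrix_sub hSm (measurable_matrix_mul hKC hSm))) ?_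
  · refine condition (T := fun ω => C ω * S ω * (C ω)ᵀ + Q) ?_
    convert h2 using 2 with ω
    rw [Matrix.fromBlocks_mulVec]
    congr 1
    · simp
    · rw [Sum.elim_comp_inl, Sum.elim_comp_inr, Matrix.sub_mulVec, Matrix.one_mulVec,
        Matrix.mulVec_add, Matrix.mulVec_mulVec, Matrix.neg_mulVec]
      abel
  · filter_upwards [h.posSemidef, hunit] with ω hω hu
    exact kalman_blockDiag (by simpa [Matrix.IsSymm] using hω.1)
      (by simpa [Matrix.IsSymm] using hQ.1) (C ω) hu (hK ω)

/-- The squared Mahalanobis norm of a conditionally normal vector is `χ²`-distributed. -/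
lemma map_mahalanobis (h : CondNormal F P e S) (hunit : ∀ᵐ ω ∂P, IsUnit (S ω))
    {d : ℕ} (hd : Fintype.card ι = d) :
    P.map (fun ω => e ω ⬝ᵥ (S ω)⁻¹ *ᵥ e ω) = chiSquared d := by
  obtain ⟨R, hR, hRsq⟩ := exists_measurable_sqrt ι
  have hSm := h.measurable_cov
  -- Whitening: with `M` the square root of `S⁻¹`, the vector `M e` has conditional covariance `1`,
  -- and its squared length is the Mahalanobis norm.
  let M : Ω → Matrix ι ι ℝ := fun ω => R (S ω)⁻¹
  have hM : Measurable[F] M := hR.comp (measurable_matrix_inv hSm)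
  have h1 := (h.mulVec hM).congr_cov (S' := fun _ => 1) measurable_const ?_
  · have hlaw : P.map (fun ω => M ω *ᵥ e ω) = Measure.pi fun _ : ι => gaussianReal 0 1 := by
      have : IsProbabilityMeasure (P.map fun ω => M ω *ᵥ e ω) :=
        Measure.isProbabilityMeasure_map h1.measurable.aemeasurable
      refine measure_ext_of_dotProduct fun t => ?_
      -- As the covariance is now constant, integrating over the whole space yields the
      -- unconditional law.
      have h2 := h1.charFun Set.univ .univ t
      rw [integral_map h1.measurable.aemeasurable (by fun_prop)]
      simp only [Measure.restrict_univ] at h2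
      rw [h2]
      simp only [Matrix.one_mulVec, integral_const, probReal_univ, one_smul]
      have h3 : ∀ x : ι → ℝ, Complex.exp ((t ⬝ᵥ x : ℝ) * Complex.I) =
          ∏ i, Complex.exp ((t i * x i : ℝ) * Complex.I) := by
        intro x
        rw [← Complex.exp_sum, dotProduct, Complex.ofReal_sum, Finset.sum_mul]
      simp_rw [h3]
      rw [integral_fintype_prod_eq_prod
        (f := fun i x => Complex.exp ((t i * x : ℝ) * Complex.I))]
      have h4 : ∀ i, ∫ x, Complex.exp ((t i * x : ℝ) * Complex.I) ∂(gaussianReal 0 1) =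
          Complex.exp ((-(t i * t i) / 2 : ℝ) : ℂ) := by
        intro i
        have := charFun_gaussianReal (μ := 0) (v := 1) (t i)
        rw [charFun_apply_real] at this
        simp only [Complex.ofReal_mul]
        rw [this]
        congr 1
        simp
        ring
      simp_rw [h4]
      rw [← Complex.exp_sum, ← Complex.ofReal_sum, dotProduct, ← Finset.sum_div,
        Finset.sum_neg_distrib]
    rw [chiSquared_eq_map hd, ← hlaw, Measure.map_map (by fun_prop) h1.measurable]
    refine Measure.map_congr ?_
    filter_upwards [h.posSemidef] with ω hω
    obtain ⟨hs, hm⟩ := hRsq _ hω.inv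
    simp only [Function.comp_apply]
    have : ∑ i, (M ω *ᵥ e ω) i ^ 2 = (M ω *ᵥ e ω) ⬝ᵥ (M ω *ᵥ e ω) := by
      simp [dotProduct, sq]
    rw [this, Matrix.dotProduct_mulVec (M ω *ᵥ e ω), ← Matrix.mulVec_transpose, Matrix.mulVec_mulVec]
    simp only [M]
    rw [hs, hm, dotProduct_comm]
  · filter_upwards [h.posSemidef, hunit] with ω hω hu
    obtain ⟨hs, hm⟩ := hRsq _ hω.inv
    have hdet : IsUnit (S ω).det := (Matrix.isUnit_iff_isUnit_det _).1 hu
    simp only [M]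
    rw [hs]
    -- For square matrices a right inverse is a left inverse, so there is no need to show that the
    -- root commutes with `S`.
    have h5 : (R (S ω)⁻¹ * S ω) * R (S ω)⁻¹ = 1 := by
      have h6 : R (S ω)⁻¹ * (R (S ω)⁻¹ * S ω) = 1 := by
        rw [← Matrix.mul_assoc, hm, Matrix.nonsing_inv_mul _ hdet]
      exact mul_eq_one_comm.1 h6
    exact h5

end CondNormal

/-! ### Information, past randomness and independence of the noise -/

/-- The information available at time `k`: the external randomness and the states up to `k`. -/
abbrev infoSigma {Ω : Type*} (𝓔 : MeasurableSpace Ω) {n : ℕ} (x : ℕ → Ω → Fin n → ℝ) (k : ℕ) :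
    MeasurableSpace Ω :=
  𝓔 ⊔ ⨆ i : Fin (k + 1), MeasurableSpace.comap (x i) inferInstance

/-- The randomness that has acted before the noise of step `k`. -/
abbrev pastSigma {Ω : Type*} (𝓔 : MeasurableSpace Ω) {n m : ℕ} (z Δz : ℕ → Ω → Param n m)
    (w : ℕ → Ω → Fin n → ℝ) (k : ℕ) : MeasurableSpace Ω :=
  𝓔 ⊔ (MeasurableSpace.comap (z 0) inferInstance ⊔
    ⨆ i ∈ Set.Iio k, MeasurableSpace.comap (fun ω => (Δz i ω, w i ω)) inferInstance)

lemma infoSigma_succ {Ω : Type*} (𝓔 : MeasurableSpace Ω) {n : ℕ} (x : ℕ → Ω → Fin n → ℝ)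
    (k : ℕ) : infoSigma 𝓔 x (k + 1) =
      infoSigma 𝓔 x k ⊔ MeasurableSpace.comap (x (k + 1)) inferInstance := by
  refine le_antisymm (sup_le ?_ (iSup_le fun i => ?_)) (sup_le (sup_le le_sup_left ?_) ?_)
  · exact le_sup_of_le_left le_sup_left
  · refine Fin.lastCases ?_ (fun j => ?_) i
    · simp
    · refine le_sup_of_le_left (le_sup_of_le_right ?_)
      exact le_iSup (fun i : Fin (k + 1) => MeasurableSpace.comap (x i) inferInstance) j
  · refine iSup_le fun i => le_sup_of_le_right ?_
    exact le_iSup (fun i : Fin (k + 1 + 1) => MeasurableSpace.comap (x i) inferInstance) i.castSucc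
  · refine le_sup_of_le_right ?_
    simpa using le_iSup (fun i : Fin (k + 1 + 1) => MeasurableSpace.comap (x i) inferInstance)
      (Fin.last (k + 1))

lemma pastSigma_mono {Ω : Type*} {𝓔 : MeasurableSpace Ω} {n m : ℕ}
    {z Δz : ℕ → Ω → Param n m} {w : ℕ → Ω → Fin n → ℝ} (k : ℕ) :
    pastSigma 𝓔 z Δz w k ≤ pastSigma 𝓔 z Δz w (k + 1) :=
  sup_le_sup_left (sup_le_sup_left (biSup_mono fun _ hi => Set.mem_Iio.2
    (Nat.lt_succ_of_lt (Set.mem_Iio.1 hi))) _) _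

lemma measurable_pair_pastSigma {Ω : Type*} {𝓔 : MeasurableSpace Ω} {n m : ℕ}
    {z Δz : ℕ → Ω → Param n m} {w : ℕ → Ω → Fin n → ℝ} (k : ℕ) :
    Measurable[pastSigma 𝓔 z Δz w (k + 1)] fun ω => (Δz k ω, w k ω) := by
  refine (comap_measurable _).mono ?_ le_rfl
  refine le_sup_of_le_right (le_sup_of_le_right ?_)
  exact le_iSup₂ (f := fun i (_ : i ∈ Set.Iio (k + 1)) =>
    MeasurableSpace.comap (fun ω => (Δz i ω, w i ω)) inferInstance) k (Set.mem_Iio.2 k.lt_succ_self)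

lemma measurable_regressor {α : Type*} {mα : MeasurableSpace α} {n m : ℕ}
    {x : α → Fin n → ℝ} {u : α → Fin m → ℝ} (hx : Measurable x) (hu : Measurable u) :
    Measurable fun a => regressor (x a) (u a) := by
  rw [measurable_matrix_iff]
  rintro i ⟨i', j⟩
  have : ∀ a, regressor (x a) (u a) i (i', j) =
      (1 : Matrix (Fin n) (Fin n) ℝ) i i' * Sum.elim (x a) (u a) j := fun a => rfl
  simp_rw [this]
  refine Measurable.const_mul ?_ _
  cases j with
  | inl j => exact (measurable_pi_apply j).comp hx
  | inr j => exact (measurable_pi_apply j).comp hu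

section Noise

variable {Ω : Type*} {𝓔 mΩ : MeasurableSpace Ω} {P : Measure Ω} {n m : ℕ}
  {z₀ : Param n m} {P₀ Sz : Matrix (ParamIdx n m) (ParamIdx n m) ℝ} {Sw : Matrix (Fin n) (Fin n) ℝ}
  {z Δz : ℕ → Ω → Param n m} {w : ℕ → Ω → Fin n → ℝ}

lemma integral_exp_of_hasLaw {ι : Type} [Fintype ι] [DecidableEq ι] {S : Matrix ι ι ℝ}
    (hS : S.PosSemidef) {μ : ι → ℝ} {d : Ω → ι → ℝ} (h : HasLaw d (normalLaw μ S) P) (t : ι → ℝ) :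
    ∫ ω, Complex.exp ((t ⬝ᵥ (d ω - μ) : ℝ) * Complex.I) ∂P =
      Complex.exp ((-(t ⬝ᵥ S *ᵥ t) / 2 : ℝ) : ℂ) := by
  have h1 := charFun_normalLaw hS μ t
  rw [← h.map_eq, integral_map h.aemeasurable (by fun_prop)] at h1
  have h2 : ∀ ω, Complex.exp ((t ⬝ᵥ (d ω - μ) : ℝ) * Complex.I) =
      Complex.exp (-((t ⬝ᵥ μ : ℝ) * Complex.I)) *
        Complex.exp ((t ⬝ᵥ d ω : ℝ) * Complex.I) := by
    intro ω
    rw [← Complex.exp_add, dotProduct_sub]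
    congr 1
    push_cast
    ring
  simp_rw [h2]
  rw [integral_const_mul, h1, ← Complex.exp_add]
  congr 1
  ring

namespace IsParameterProcess

variable (hz : IsParameterProcess 𝓔 P z₀ P₀ Sz Sw z Δz w)
include hz

lemma measurable_pair (k : ℕ) : Measurable fun ω => (Δz k ω, w k ω) :=
  (hz.measurable_Δz k).prodMk (hz.measurable_w k)

lemma pastSigma_le (k : ℕ) : pastSigma 𝓔 z Δz w k ≤ mΩ :=
  sup_le hz.exogenous_le (sup_le hz.measurable_init.comap_le
    (iSup₂_le fun i _ => (hz.measurable_pair i).comap_le))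

lemma measurable_walk (k : ℕ) : Measurable[pastSigma 𝓔 z Δz w k] (z k) := by
  induction k with
  | zero =>
    refine (comap_measurable _).mono ?_ le_rfl
    exact le_sup_of_le_right le_sup_left
  | succ k ih =>
    have : z (k + 1) = fun ω => z k ω + Δz k ω := funext (hz.walk k)
    rw [this]
    exact (ih.mono (pastSigma_mono k) le_rfl).add (measurable_pair_pastSigma k).fst

/-- Independence over time handles the earlier noise; `indep_sup_left` then adjoins first the
initial parameter and then the external randomness. -/
lemma indep_pastSigma [IsProbabilityMeasure P] (k : ℕ) :
    Indep (pastSigma 𝓔 z Δz w k)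
      (MeasurableSpace.comap (fun ω => (Δz k ω, w k ω)) inferInstance) P := by
  have hpast : (⨆ i ∈ Set.Iio k,
      MeasurableSpace.comap (fun ω => (Δz i ω, w i ω)) inferInstance) ≤ mΩ :=
    iSup₂_le fun i _ => (hz.measurable_pair i).comap_le
  have hcomap : ∀ i, MeasurableSpace.comap (fun ω => (Δz i ω, w i ω)) inferInstance ≤
      MeasurableSpace.comap (fun ω k => (Δz k ω, w k ω)) inferInstance := fun i =>
    ((measurable_pi_apply i).comp
      (comap_measurable (fun ω k => (Δz k ω, w k ω)))).comap_le
  have hall : (⨆ i ∈ Set.Iio k,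
      MeasurableSpace.comap (fun ω => (Δz i ω, w i ω)) inferInstance) ⊔
      MeasurableSpace.comap (fun ω => (Δz k ω, w k ω)) inferInstance ≤
      MeasurableSpace.comap (fun ω k => (Δz k ω, w k ω)) inferInstance :=
    sup_le (iSup₂_le fun i _ => hcomap i) (hcomap k)
  have h1 : Indep (⨆ i ∈ Set.Iio k,
      MeasurableSpace.comap (fun ω => (Δz i ω, w i ω)) inferInstance)
      (MeasurableSpace.comap (fun ω => (Δz k ω, w k ω)) inferInstance) P := by
    have := indep_iSup_of_disjoint (S := Set.Iio k) (T := {k})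
      (fun i => (hz.measurable_pair i).comap_le) hz.indep_time.iIndep (by simp)
    simpa using this
  have h2 := indep_sup_left hz.measurable_init.comap_le hpast (hz.measurable_pair k).comap_le
    (indep_of_indep_of_le_right ((IndepFun_iff_Indep _ _ _).1 hz.indep_init) hall) h1
  refine indep_sup_left hz.exogenous_le (sup_le hz.measurable_init.comap_le hpast)
    (hz.measurable_pair k).comap_le (indep_of_indep_of_le_right hz.indep_exogenous ?_) h2
  have hpair : Measurable[MeasurableSpace.comap (fun ω => (z 0 ω, fun k => (Δz k ω, w k ω)))
      inferInstance] fun ω => (z 0 ω, fun k => (Δz k ω, w k ω)) := comap_measurable _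
  rw [sup_assoc]
  exact sup_le hpair.fst.comap_le (hall.trans hpair.snd.comap_le)

lemma integral_Δz (hSz : Sz.PosSemidef) (k : ℕ) (t : ParamIdx n m → ℝ) :
    ∫ ω, Complex.exp ((t ⬝ᵥ Δz k ω : ℝ) * Complex.I) ∂P =
      Complex.exp ((-(t ⬝ᵥ Sz *ᵥ t) / 2 : ℝ) : ℂ) := by
  simpa only [sub_zero] using integral_exp_of_hasLaw hSz (hz.law_Δz k) t

lemma integral_w (hSw : Sw.PosSemidef) (k : ℕ) (t : Fin n → ℝ) :
    ∫ ω, Complex.exp ((t ⬝ᵥ w k ω : ℝ) * Complex.I) ∂P =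
      Complex.exp ((-(t ⬝ᵥ Sw *ᵥ t) / 2 : ℝ) : ℂ) := by
  simpa only [sub_zero] using integral_exp_of_hasLaw hSw (hz.law_w k) t

lemma integral_eval_Δz (k : ℕ) (i : ParamIdx n m) : ∫ ω, Δz k ω i ∂P = 0 := by
  have h : ∫ x : Param n m, x i ∂(normalLaw 0 Sz) = 0 := by
    rw [normalLaw, integral_map (by fun_prop)
      (Measurable.aestronglyMeasurable (by fun_prop))]
    have h1 := (EuclideanSpace.proj i : EuclideanSpace ℝ (ParamIdx n m) →L[ℝ] ℝ).integral_comp_id_comm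
      (μ := multivariateGaussian (WithLp.toLp 2 (0 : Param n m)) Sz) IsGaussian.integrable_id
    simpa using h1
  rw [← (hz.law_Δz k).map_eq, integral_map (hz.measurable_Δz k).aemeasurable
    (Measurable.aestronglyMeasurable (by fun_prop))] at h
  exact h

/-- Jointly Gaussian, uncorrelated vectors are independent. The vanishing product moments are
covariances because `Δz k` is centred. -/
lemma indepFun_pair [IsProbabilityMeasure P] (k : ℕ) : IndepFun (Δz k) (w k) P := by
  refine HasGaussianLaw.indepFun_of_covariance_eval (X := fun i ω => Δz k ω i)
    (Y := fun j ω => w k ω j) (hz.gaussian_pair k) fun i j => ?_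
  have hX : MemLp (fun ω => Δz k ω i) 2 P :=
    ((hz.gaussian_pair k).fst.eval i).memLp_two
  have hY : MemLp (fun ω => w k ω j) 2 P :=
    ((hz.gaussian_pair k).snd.eval j).memLp_two
  rw [covariance_eq_sub hX hY]
  simp [hz.integral_eval_Δz k i, hz.uncorrelated k i j]

/-- Needed when the observed parameter is `z (k + 1)`, which already contains `Δz k`. -/
lemma indep_w [IsProbabilityMeasure P] (k : ℕ) :
    Indep (pastSigma 𝓔 z Δz w k ⊔ MeasurableSpace.comap (Δz k) inferInstance)
      (MeasurableSpace.comap (w k) inferInstance) P := by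
  refine indep_sup_left (hz.pastSigma_le k) (hz.measurable_Δz k).comap_le
    (hz.measurable_w k).comap_le (indep_of_indep_of_le_right (hz.indep_pastSigma k) ?_)
    ((IndepFun_iff_Indep _ _ _).1 (hz.indepFun_pair k))
  exact sup_le (comap_measurable (fun ω => (Δz k ω, w k ω))).fst.comap_le
    (comap_measurable (fun ω => (Δz k ω, w k ω))).snd.comap_le

/-- Needed when the prediction follows the correction: the information then contains `x (k + 1)`,
and through it `w k`. -/
lemma indep_Δz [IsProbabilityMeasure P] (k : ℕ) :
    Indep (pastSigma 𝓔 z Δz w k ⊔ MeasurableSpace.comap (w k) inferInstance)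
      (MeasurableSpace.comap (Δz k) inferInstance) P := by
  refine indep_sup_left (hz.pastSigma_le k) (hz.measurable_w k).comap_le
    (hz.measurable_Δz k).comap_le (indep_of_indep_of_le_right (hz.indep_pastSigma k) ?_)
    ((IndepFun_iff_Indep _ _ _).1 (hz.indepFun_pair k)).symm
  exact sup_le (comap_measurable (fun ω => (Δz k ω, w k ω))).snd.comap_le
    (comap_measurable (fun ω => (Δz k ω, w k ω))).fst.comap_le

/-- The prior: given the external randomness, `z 0 - z₀` is `𝒩(0, P₀)`-distributed. -/
lemma condNormal_init [IsProbabilityMeasure P] (hP₀ : P₀.PosSemidef) :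
    CondNormal 𝓔 P (fun ω => z 0 ω - z₀) (fun _ => P₀) := by
  -- Start from the degenerate law at zero and add `z 0 - z₀` as independent noise.
  have hzero : CondNormal 𝓔 P (fun _ => (0 : Param n m)) (fun _ => 0) := by
    refine ⟨hz.exogenous_le, measurable_const, measurable_const,
      ae_of_all _ fun _ => Matrix.PosSemidef.zero, fun A _ t => by simp⟩
  have h := hzero.add_indep (d := fun ω => z 0 ω - z₀) (hz.measurable_init.sub_const z₀) hP₀
    (integral_exp_of_hasLaw hP₀ hz.law_init) ?_
  · simpa using h
  · refine indep_of_indep_of_le hz.indep_exogenous ?_ ?_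
    · exact sup_le le_rfl (measurable_const : Measurable[𝓔] _).comap_le
    · exact ((comap_measurable (fun ω => (z 0 ω, fun k => (Δz k ω, w k ω)))).fst.sub_const
        z₀).comap_le

end IsParameterProcess

end Noise

/-! ### Filter updates as posterior updates, and the trigger probability -/

section Posterior

/-- `(ẑ, P)` is the conditional mean and error covariance of `θ` given `F`. -/
structure IsPosterior {Ω : Type*} (F : MeasurableSpace Ω) [mΩ : MeasurableSpace Ω] (P : Measure Ω)
    {n m : ℕ} (θ : Ω → Param n m) (s : Ω → Estimate n m) : Prop where
  condNormal : CondNormal F P (fun ω => θ ω - (s ω).mean) (fun ω => (s ω).cov)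
  measurable_mean : Measurable[F] fun ω => (s ω).mean

namespace IsPosterior

variable {Ω : Type*} {F G mΩ : MeasurableSpace Ω} {P : Measure Ω}
  {n m : ℕ} {Sz : Matrix (ParamIdx n m) (ParamIdx n m) ℝ} {Sw : Matrix (Fin n) (Fin n) ℝ}
  {θ : Ω → Param n m} {s : Ω → Estimate n m}

/-- The estimate is `F`-measurable, so independence of the noise from any `G` that carries `F` and
`θ` suffices for the updates. -/
lemma sup_comap_error_le (h : IsPosterior F P θ s) (hF : F ≤ G)
    (hθ : Measurable[G] θ) :
    F ⊔ MeasurableSpace.comap (fun ω => θ ω - (s ω).mean) inferInstance ≤ G :=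
  sup_le hF (hθ.sub (h.measurable_mean.mono hF le_rfl)).comap_le

/-- The time update yields the posterior of `θ + d`. -/
lemma predict [IsProbabilityMeasure P] (h : IsPosterior F P θ s) {d : Ω → Param n m} (hd : Measurable d)
    (hSz : Sz.PosSemidef)
    (hlaw : ∀ t : ParamIdx n m → ℝ, ∫ ω, Complex.exp ((t ⬝ᵥ d ω : ℝ) * Complex.I) ∂P =
      Complex.exp ((-(t ⬝ᵥ Sz *ᵥ t) / 2 : ℝ) : ℂ)) (hF : F ≤ G) (hθ : Measurable[G] θ)
    (hind : Indep G (MeasurableSpace.comap d inferInstance) P) :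
    IsPosterior F P (fun ω => θ ω + d ω) (fun ω => (s ω).predict Sz) := by
  refine ⟨?_, h.measurable_mean⟩
  convert h.condNormal.add_indep hd hSz hlaw
    (indep_of_indep_of_le_left hind (h.sup_comap_error_le hF hθ)) using 2 with ω
  · simp only [Estimate.predict]
    abel
  · rfl

/-- The measurement update yields the posterior of `θ` given also `C θ + w`. -/
lemma correct [IsProbabilityMeasure P] (h : IsPosterior F P θ s) {C : Ω → Matrix (Fin n) (ParamIdx n m) ℝ}
    (hC : Measurable[F] C) {w : Ω → Fin n → ℝ} (hw : Measurable w) (hSw : Sw.PosSemidef)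
    (hlaw : ∀ t : Fin n → ℝ, ∫ ω, Complex.exp ((t ⬝ᵥ w ω : ℝ) * Complex.I) ∂P =
      Complex.exp ((-(t ⬝ᵥ Sw *ᵥ t) / 2 : ℝ) : ℂ)) (hF : F ≤ G) (hθ : Measurable[G] θ)
    (hind : Indep G (MeasurableSpace.comap w inferInstance) P)
    (hunit : ∀ᵐ ω ∂P, IsUnit ((s ω).innovationCov Sw (C ω)))
    {y : Ω → Fin n → ℝ} (hy : ∀ ω, y ω = C ω *ᵥ θ ω + w ω) :
    IsPosterior (F ⊔ MeasurableSpace.comap y inferInstance) P θ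
      (fun ω => (s ω).correct Sw (C ω) (y ω)) := by
  have hν : ∀ ω, C ω *ᵥ (θ ω - (s ω).mean) + w ω = y ω - C ω *ᵥ (s ω).mean := by
    intro ω
    rw [hy, Matrix.mulVec_sub]
    abel
  have hCm : Measurable[F] fun ω => C ω *ᵥ (s ω).mean := measurable_mulVec hC h.measurable_mean
  -- Since `C ẑ` is `F`-measurable, the innovation and the observation `y` carry the same
  -- information beyond `F`.
  have hsig : F ⊔ MeasurableSpace.comap
      (fun ω => C ω *ᵥ (θ ω - (s ω).mean) + w ω) inferInstance =
      F ⊔ MeasurableSpace.comap y inferInstance := by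
    simp_rw [hν]
    refine le_antisymm (sup_le le_sup_left (Measurable.comap_le ?_))
      (sup_le le_sup_left (Measurable.comap_le ?_))
    · exact ((comap_measurable y).mono le_sup_right le_rfl).sub (hCm.mono le_sup_left le_rfl)
    · have h1 : Measurable[F ⊔ MeasurableSpace.comap (fun ω => y ω - C ω *ᵥ (s ω).mean)
          inferInstance] fun ω => (y ω - C ω *ᵥ (s ω).mean) + C ω *ᵥ (s ω).mean :=
        ((comap_measurable (fun ω => y ω - C ω *ᵥ (s ω).mean)).mono le_sup_right le_rfl).add
          (hCm.mono le_sup_left le_rfl)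
      simpa using h1
  have h1 := h.condNormal.correct hC hw hSw hlaw
    (indep_of_indep_of_le_left hind (h.sup_comap_error_le hF hθ))
    (K := fun ω => (s ω).gain Sw (C ω)) (fun ω => rfl) hunit
  rw [hsig] at h1
  have hcov := h.condNormal.measurable_cov
  have hgain : Measurable[F] fun ω => (s ω).gain Sw (C ω) := by
    have hCt := measurable_matrix_transpose hC
    exact measurable_matrix_mul (measurable_matrix_mul hcov hCt) (measurable_matrix_inv
      (measurable_matrix_add (measurable_matrix_mul (measurable_matrix_mul hC hcov) hCt)
        measurable_const))
  refine ⟨?_, ?_⟩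
  · convert h1 using 2 with ω
    · rw [hν]
      simp only [Estimate.correct]
      abel
    · rfl
  · have hl : F ≤ F ⊔ MeasurableSpace.comap y inferInstance := le_sup_left
    exact (h.measurable_mean.mono hl le_rfl).add (measurable_mulVec (hgain.mono hl le_rfl)
      (((comap_measurable y).mono le_sup_right le_rfl).sub (hCm.mono hl le_rfl)))

/-- Under a perfect model the trigger fires with probability at most `α`. -/
lemma measure_learningTrigger_le [IsProbabilityMeasure P] (h : IsPosterior F P θ s)
    (hunit : ∀ᵐ ω ∂P, IsUnit (s ω).cov) {α : ℝ} (hα₀ : 0 < α)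
    {zstar : Ω → Param n m} (hstar : ∀ᵐ ω ∂P, zstar ω = θ ω) :
    P {ω | learningTrigger α (s ω) (zstar ω) = 1} ≤ ENNReal.ofReal α := by
  set q := quantile (chiSquared (n * (n + m))) (1 - α) with hq
  have hcard : Fintype.card (ParamIdx n m) = n * (n + m) := by simp
  have hmap := h.condNormal.map_mahalanobis hunit hcard
  have hmeas : Measurable fun ω =>
      (θ ω - (s ω).mean) ⬝ᵥ ((s ω).cov)⁻¹ *ᵥ (θ ω - (s ω).mean) :=
    measurable_dotProduct h.condNormal.measurable (measurable_mulVec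
      (measurable_matrix_inv (h.condNormal.measurable_cov.mono h.condNormal.le le_rfl))
      h.condNormal.measurable)
  have hae : {ω | learningTrigger α (s ω) (zstar ω) = 1} =ᵐ[P]
      (fun ω => (θ ω - (s ω).mean) ⬝ᵥ ((s ω).cov)⁻¹ *ᵥ (θ ω - (s ω).mean)) ⁻¹' Set.Ioi q := by
    filter_upwards [hstar] with ω hω
    have hneg : (s ω).mahalanobisSq (zstar ω) =
        (θ ω - (s ω).mean) ⬝ᵥ ((s ω).cov)⁻¹ *ᵥ (θ ω - (s ω).mean) := by
      rw [Estimate.mahalanobisSq, hω, ← neg_sub (θ ω), Matrix.mulVec_neg, neg_dotProduct_neg]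
    refine propext ?_
    change learningTrigger α (s ω) (zstar ω) = 1 ↔
      (θ ω - (s ω).mean) ⬝ᵥ ((s ω).cov)⁻¹ *ᵥ (θ ω - (s ω).mean) > q
    simp only [learningTrigger, hneg, hq, ite_eq_left_iff, zero_ne_one, imp_false, not_not]
  have := isProbabilityMeasure_chiSquared (n * (n + m))
  rw [measure_congr hae, ← Measure.map_apply hmeas measurableSet_Ioi, hmap]
  exact measure_Ioi_quantile_le _ hα₀

end IsPosterior

end Posterior

/-! ### Induction along the trajectory in both timing conventions -/

section Trajectory

variable {Ω : Type*} {𝓔 mΩ : MeasurableSpace Ω} {P : Measure Ω} {n m : ℕ}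
  {z₀ : Param n m} {P₀ Sz : Matrix (ParamIdx n m) (ParamIdx n m) ℝ} {Sw : Matrix (Fin n) (Fin n) ℝ}
  {z Δz : ℕ → Ω → Param n m} {w : ℕ → Ω → Fin n → ℝ} {θ : ℕ → Ω → Param n m}
  {x : ℕ → Ω → Fin n → ℝ} {u : ℕ → Ω → Fin m → ℝ}

namespace IsTrajectory

lemma infoSigma_zero (ht : IsTrajectory 𝓔 θ w x u) : infoSigma 𝓔 x 0 = 𝓔 := by
  refine le_antisymm (sup_le le_rfl (iSup_le fun i => ?_)) le_sup_left
  have : (i : ℕ) = 0 := by omega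
  rw [this]
  exact ht.init.comap_le

lemma measurable_input (ht : IsTrajectory 𝓔 θ w x u) (k : ℕ) :
    Measurable[infoSigma 𝓔 x k] (u k) := ht.causal k

lemma measurable_state (k : ℕ) : Measurable[infoSigma 𝓔 x k] (x k) := by
  refine (comap_measurable _).mono (le_sup_of_le_right ?_) le_rfl
  simpa using le_iSup (fun i : Fin (k + 1) => MeasurableSpace.comap (x i) inferInstance)
      (Fin.last k)

lemma measurable_regressor (ht : IsTrajectory 𝓔 θ w x u) (k : ℕ) :
    Measurable[infoSigma 𝓔 x k] fun ω => regressor (x k ω) (u k ω) :=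
  ParameterFilter.measurable_regressor (measurable_state k) (ht.measurable_input k)

/-- Causality of the inputs drives the induction. Allowing `θ k` to use the noise of step `k` covers
both `z k` and `z (k + 1)`. -/
lemma infoSigma_le_pastSigma (ht : IsTrajectory 𝓔 θ w x u)
    (hθ : ∀ k, Measurable[pastSigma 𝓔 z Δz w (k + 1)] (θ k)) (k : ℕ) :
    infoSigma 𝓔 x k ≤ pastSigma 𝓔 z Δz w k := by
  induction k with
  | zero => rw [ht.infoSigma_zero]; exact le_sup_left
  | succ k ih =>
    have ih' := ih.trans (pastSigma_mono k)
    rw [infoSigma_succ]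
    refine sup_le ih' (Measurable.comap_le ?_)
    have : x (k + 1) = fun ω => regressor (x k ω) (u k ω) *ᵥ θ k ω + w k ω := funext (ht.step k)
    rw [this]
    exact (measurable_mulVec ((ht.measurable_regressor k).mono ih' le_rfl) (hθ k)).add
      (measurable_pair_pastSigma k).snd

end IsTrajectory

variable [IsProbabilityMeasure P]

/-- The filter with the correction before the prediction computes the posterior of `z k`. -/
lemma isPosterior_correctPredict (hP₀ : P₀.PosSemidef) (hSz : Sz.PosSemidef)
    (hSw : Sw.PosSemidef) (hz : IsParameterProcess 𝓔 P z₀ P₀ Sz Sw z Δz w)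
    (ht : IsTrajectory 𝓔 (fun j => z j) w x u) {est : ℕ → Ω → Estimate n m}
    (hest : ∀ j ω, est j ω =
      correctPredict Sz Sw ⟨z₀, P₀⟩ (fun i => x i ω) (fun i => u i ω) j) (k : ℕ)
    (hunit : ∀ j < k, ∀ᵐ ω ∂P,
      IsUnit ((est j ω).innovationCov Sw (regressor (x j ω) (u j ω)))) :
    IsPosterior (infoSigma 𝓔 x k) P (z k) (est k) := by
  induction k with
  | zero =>
    have : est 0 = fun _ => ⟨z₀, P₀⟩ := funext (hest 0)
    rw [ht.infoSigma_zero, this]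
    exact ⟨hz.condNormal_init hP₀, measurable_const⟩
  | succ k ih =>
    have ih := ih fun j hj => hunit j (hj.trans k.lt_succ_self)
    have hle := ht.infoSigma_le_pastSigma
      (fun j => (hz.measurable_walk j).mono (pastSigma_mono j) le_rfl) k
    have hstep : est (k + 1) = fun ω => ((est k ω).correct Sw
        (regressor (x k ω) (u k ω)) (x (k + 1) ω)).predict Sz := by
      funext ω
      rw [hest, hest, correctPredict]
    have hwalk : z (k + 1) = fun ω => z k ω + Δz k ω := funext (hz.walk k)
    have hcorr := ih.correct (ht.measurable_regressor k) (hz.measurable_w k) hSw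
      (hz.integral_w hSw k) hle (hz.measurable_walk k)
      (indep_of_indep_of_le_left (hz.indep_w k) le_sup_left) (hunit k k.lt_succ_self)
      (ht.step k)
    rw [infoSigma_succ, hstep, hwalk]
    have hzm : Measurable[pastSigma 𝓔 z Δz w k ⊔ MeasurableSpace.comap (w k) inferInstance] (z k) :=
      (hz.measurable_walk k).mono le_sup_left le_rfl
    have hle' : infoSigma 𝓔 x k ≤ pastSigma 𝓔 z Δz w k ⊔
        MeasurableSpace.comap (w k) inferInstance := hle.trans le_sup_left
    -- The corrected information involves `w k`, so the enclosing σ-algebra is the past enlarged by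
    -- `w k`.
    refine hcorr.predict (hz.measurable_Δz k) hSz (hz.integral_Δz hSz k)
      (sup_le hle' (Measurable.comap_le ?_)) hzm (hz.indep_Δz k)
    rw [show x (k + 1) = _ from funext (ht.step k)]
    exact (measurable_mulVec ((ht.measurable_regressor k).mono hle' le_rfl)
      hzm).add ((comap_measurable (w k)).mono le_sup_right le_rfl)

/-- The filter with the prediction before the correction computes the posterior of `z k`. -/
lemma isPosterior_predictCorrect (hP₀ : P₀.PosSemidef) (hSz : Sz.PosSemidef)
    (hSw : Sw.PosSemidef) (hz : IsParameterProcess 𝓔 P z₀ P₀ Sz Sw z Δz w)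
    (ht : IsTrajectory 𝓔 (fun j => z (j + 1)) w x u) {est : ℕ → Ω → Estimate n m}
    (hest : ∀ j ω, est j ω =
      predictCorrect Sz Sw ⟨z₀, P₀⟩ (fun i => x i ω) (fun i => u i ω) j) (k : ℕ)
    (hunit : ∀ j < k, ∀ᵐ ω ∂P,
      IsUnit (((est j ω).predict Sz).innovationCov Sw (regressor (x j ω) (u j ω)))) :
    IsPosterior (infoSigma 𝓔 x k) P (z k) (est k) := by
  induction k with
  | zero =>
    have : est 0 = fun _ => ⟨z₀, P₀⟩ := funext (hest 0)
    rw [ht.infoSigma_zero, this]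
    exact ⟨hz.condNormal_init hP₀, measurable_const⟩
  | succ k ih =>
    have ih := ih fun j hj => hunit j (hj.trans k.lt_succ_self)
    have hle := ht.infoSigma_le_pastSigma (fun j => hz.measurable_walk (j + 1)) k
    have hstep : est (k + 1) = fun ω => ((est k ω).predict Sz).correct Sw
        (regressor (x k ω) (u k ω)) (x (k + 1) ω) := by
      funext ω
      rw [hest, hest, predictCorrect]
    have hwalk : z (k + 1) = fun ω => z k ω + Δz k ω := funext (hz.walk k)
    have hpred := ih.predict (hz.measurable_Δz k) hSz (hz.integral_Δz hSz k) hle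
      (hz.measurable_walk k) (indep_of_indep_of_le_left (hz.indep_Δz k) le_sup_left)
    rw [← hwalk] at hpred
    rw [infoSigma_succ, hstep]
    -- Here the estimated parameter is `z (k + 1)`, so the enclosing σ-algebra is the past enlarged
    -- by `Δz k`.
    refine hpred.correct (ht.measurable_regressor k) (hz.measurable_w k) hSw
      (hz.integral_w hSw k) (hle.trans le_sup_left) ?_ (hz.indep_w k) (hunit k k.lt_succ_self)
      (ht.step k)
    rw [hwalk]
    exact ((hz.measurable_walk k).mono le_sup_left le_rfl).add
      ((comap_measurable (Δz k)).mono le_sup_right le_rfl)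

end Trajectory

end ParameterFilter

end

open ParameterFilter in
theorem theorem1 {Ω : Type*} (𝓔 : MeasurableSpace Ω) [mΩ : MeasurableSpace Ω] (P : Measure Ω)
    [IsProbabilityMeasure P] (n m : ℕ)
    (z₀ : Param n m) (P₀ Sz : Matrix (ParamIdx n m) (ParamIdx n m) ℝ)
    (Sw : Matrix (Fin n) (Fin n) ℝ)
    (hP₀ : P₀.PosSemidef) (hSz : Sz.PosSemidef) (hSw : Sw.PosSemidef)
    (z Δz : ℕ → Ω → Param n m) (w : ℕ → Ω → Fin n → ℝ)
    (hz : IsParameterProcess 𝓔 P z₀ P₀ Sz Sw z Δz w)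
    (x : ℕ → Ω → Fin n → ℝ) (u : ℕ → Ω → Fin m → ℝ)
    (α : ℝ) (hα₀ : 0 < α) (hα₁ : α < 1)
    (k : ℕ) (zstar : Ω → Param n m) (hstar : ∀ᵐ ω ∂P, zstar ω = z k ω) :
    -- `x (k+1) = C k * z k + w k`; all inverses in the filter and in the trigger exist
    (∀ est : ℕ → Ω → Estimate n m,
      (∀ j ω, est j ω = correctPredict Sz Sw ⟨z₀, P₀⟩ (fun i => x i ω) (fun i => u i ω) j) →
      IsTrajectory 𝓔 (fun j => z j) w x u →
      (∀ j < k, ∀ᵐ ω ∂P,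
        IsUnit ((est j ω).innovationCov Sw (regressor (x j ω) (u j ω)))) →
      (∀ᵐ ω ∂P, IsUnit (est k ω).cov) →
      P {ω | learningTrigger α (est k ω) (zstar ω) = 1} ≤ ENNReal.ofReal α) ∧
    -- the same with `x (k+1) = C k * z (k+1) + w k`
    (∀ est : ℕ → Ω → Estimate n m,
      (∀ j ω, est j ω = predictCorrect Sz Sw ⟨z₀, P₀⟩ (fun i => x i ω) (fun i => u i ω) j) →
      IsTrajectory 𝓔 (fun j => z (j + 1)) w x u →
      (∀ j < k, ∀ᵐ ω ∂P,
        IsUnit (((est j ω).predict Sz).innovationCov Sw (regressor (x j ω) (u j ω)))) →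
      (∀ᵐ ω ∂P, IsUnit (est k ω).cov) →
      P {ω | learningTrigger α (est k ω) (zstar ω) = 1} ≤ ENNReal.ofReal α) := by
  refine ⟨fun est hest ht hunit hcov => ?_, fun est hest ht hunit hcov => ?_⟩
  · exact (isPosterior_correctPredict hP₀ hSz hSw hz ht hest k hunit).measure_learningTrigger_le
      hcov hα₀ hstar
  · exact (isPosterior_predictCorrect hP₀ hSz hSw hz ht hest k hunit).measure_learningTrigger_le
      hcov hα₀ hstar
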